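/- **Definitions.** For $C\in\mathbb C^{n\times n}$ let $W'(C)=\{x^*Cx : x\in\mathbb C^n,\ x\ne 0\}$. The field angle $\delta(C)$ is the angle subtended by $W'(C)$ if $W'(C)$ contains no line through the origin, it is $\pi$ if $W'(C)$ contains exactly one such line, and $2\pi$ if $W'(C)=\mathbb C$. The matrix $C$ is *semi-sectorial* if $\delta(C)\le\pi$. Let $r=\operatorname{rank}(C)$. A *selection of the phases* of $C$ is a vector of real numbers $\phi_1(C)\ge\dots\ge\phi_r(C)$ obtained as follows: for some nonsingular $T$, some $\theta_0\in\mathbb R$ and some $\theta_1,\dots,\theta_m\in[\theta_0-\frac\pi2,\theta_0+\frac\pi2]$, $$C=T^*\begin{bmatrix}0_{n-r}&0&0\\0&D&0\\0&0&E\end{bmatrix}T,\qquad D=\operatorname{diag}(e^{i\theta_1},\dots,e^{i\theta_m}),\qquad E=\operatorname{diag}\Big(e^{i\theta_0}\begin{bmatrix}1&2\\0&1\end{bmatrix},\dots,e^{i\theta_0}\begin{bmatrix}1&2\\0&1\end{bmatrix}\Big),$$ and $\phi_1(C),\dots,\phi_r(C)$ are the numbers $\theta_1,\dots,\theta_m$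 together with $\frac{r-m}2$ copies of $\theta_0+\frac\pi2$ and $\frac{r-m}2$ copies of $\theta_0-\frac\pi2$, in non-increasing order ($D$ or $E$ may be empty). If $r\geq 1$, the phase center of the selection is $\gamma(C)=\frac12(\phi_1(C)+\phi_r(C))$. A *compression* of $C$ is a matrix $\tilde C=X^*CX$ with $X\in\mathbb C^{n\times k}$ of full column rank. **Lemma.** Let $C\in\mathbb C^{n\times n}$ be a nonzero semi-sectorial matrix and let $\tilde C$ be a nonzero compression of $C$. Put $r=\operatorname{rank}(C)$ and $\tilde r=\operatorname{rank}(\tilde C)$. Then $\tilde C$ is semi-sectorial and the phases of $C$ and $\tilde C$ interlace, in the following sense. A selection of the phases of $C$ exists; for every selection of the phases of $C$ there is a selection of the phases of $\tilde C$ with $|\gamma(\tilde C)-\gamma(C)|<\pi$; and for all selections of the phases of $C$ and of $\tilde C$ with $|\gamma(\tilde C)-\gamma(C)|<\pi$, $$\phi_j(C)\ \ge\ \phi_j(\tilde C)\ \ge\ \phi_{r-\tilde r+j}(C),\qquad j=1,\dots,\tilde r.$$ -/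

import Mathlib

open Matrix

namespace MatrixPhase

/-- The angular numerical range `W'(C) = {x* C x : x ∈ ℂⁿ, x ≠ 0}`. -/
def angularNumericalRange {n : ℕ} (C : Matrix (Fin n) (Fin n) ℂ) : Set ℂ :=
  {w | ∃ x : Fin n → ℂ, x ≠ 0 ∧ w = star x ⬝ᵥ (C *ᵥ x)}

/-- The closed angular sector with apex `0` between the directions `a` and `b`. -/
def sector (a b : ℝ) : Set ℂ :=
  {w | ∃ ρ t : ℝ, 0 ≤ ρ ∧ a ≤ t ∧ t ≤ b ∧ w = (ρ : ℂ) * Complex.exp ((t : ℂ) * Complex.I)}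

/-- The angle subtended by a set: the smallest opening angle of a sector that contains it. -/
noncomputable def subtendedAngle (S : Set ℂ) : ℝ :=
  sInf {d : ℝ | 0 ≤ d ∧ ∃ a : ℝ, S ⊆ sector a (a + d)}

/-- `S` contains a (full) line through the origin. -/
def ContainsLine (S : Set ℂ) : Prop :=
  ∃ u : ℂ, u ≠ 0 ∧ ∀ t : ℝ, (t : ℂ) * u ∈ S

open Classical in
/-- The field angle `δ(C)`: it is `2π` if `W'(C)` is the whole plane, `π` if `W'(C)` contains
exactly one line through the origin (for a convex cone other than the plane, this means at least
one line), and the angle subtended by `W'(C)` if `W'(C)` is salient. -/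
noncomputable def fieldAngle {n : ℕ} (C : Matrix (Fin n) (Fin n) ℂ) : ℝ :=
  if angularNumericalRange C = Set.univ then 2 * Real.pi
  else if ContainsLine (angularNumericalRange C) then Real.pi
  else subtendedAngle (angularNumericalRange C)

/-- `C` is semi-sectorial if `δ(C) ≤ π`. -/
def IsSemiSectorial {n : ℕ} (C : Matrix (Fin n) (Fin n) ℂ) : Prop :=
  fieldAngle C ≤ Real.pi

/-- The middle factor `0 ⊕ D ⊕ E` of a generalized sectorial decomposition, where
`D = diag(e^{iθ₁}, …, e^{iθₘ})` and `E` consists of `p` diagonal blocks `e^{iθ₀} [1 2; 0 1]`. -/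
noncomputable def gsdMiddle (z m p : ℕ) (θ₀ : ℝ) (θ : Fin m → ℝ) :
    Matrix (Fin z ⊕ (Fin m ⊕ (Fin 2 × Fin p))) (Fin z ⊕ (Fin m ⊕ (Fin 2 × Fin p))) ℂ :=
  Matrix.fromBlocks 0 0 0
    (Matrix.fromBlocks
      (Matrix.diagonal fun k => Complex.exp ((θ k : ℂ) * Complex.I)) 0 0
      (Matrix.blockDiagonal fun _ : Fin p =>
        Complex.exp ((θ₀ : ℂ) * Complex.I) • (!![1, 2; 0, 1] : Matrix (Fin 2) (Fin 2) ℂ)))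

/-- `IsPhases C φ`: the vector `φ = (φ₁ ≥ … ≥ φᵣ)`, with `r = rank C`, is an admissible selection
of the phases of `C`. That is, `C = T* (0 ⊕ D ⊕ E) T` with `T` nonsingular and
`θ₁, …, θₘ ∈ [θ₀ - π/2, θ₀ + π/2]`, and `φ` lists, in non-increasing order, the numbers
`θ₁, …, θₘ` together with `p = (r - m)/2` copies of `θ₀ + π/2` and `p` copies of `θ₀ - π/2`.

Sectorial and quasi-sectorial matrices (for which all phases lie in an open interval of length
`π`) and rotated Hermitian matrices (for which all phases are `θ₀ ± π/2`) are the cases without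
`E`, that is `p = 0`. As usual, phases are determined only up to the choice of the phase center:
modulo a common shift by `2π`, and for rotated Hermitian matrices `θ₀` is determined
modulo `π`. -/
def IsPhases {n : ℕ} (C : Matrix (Fin n) (Fin n) ℂ) (φ : Fin C.rank → ℝ) : Prop :=
  Antitone φ ∧
  ∃ (z m p : ℕ) (e : (Fin z ⊕ (Fin m ⊕ (Fin 2 × Fin p))) ≃ Fin n)
    (θ₀ : ℝ) (θ : Fin m → ℝ) (T : Matrix (Fin n) (Fin n) ℂ)
    (σ : Fin C.rank ≃ (Fin m ⊕ (Fin p ⊕ Fin p))),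
    (∀ k, θ₀ - Real.pi / 2 ≤ θ k ∧ θ k ≤ θ₀ + Real.pi / 2) ∧
    IsUnit T.det ∧
    C = Tᴴ * Matrix.reindex e e (gsdMiddle z m p θ₀ θ) * T ∧
    ∀ j, φ j = Sum.elim θ
      (Sum.elim (fun _ => θ₀ + Real.pi / 2) (fun _ => θ₀ - Real.pi / 2)) (σ j)

/-- The phase center `γ = (max φ + min φ)/2` of a (nonempty) vector of phases. -/
noncomputable def phaseCenter {r : ℕ} (φ : Fin r → ℝ) : ℝ :=
  ((⨆ i, φ i) + (⨅ i, φ i)) / 2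

/-- `B` is a compression of `C`: `B = X* C X` for a matrix `X` of full column rank. -/
def IsCompression {n k : ℕ} (B : Matrix (Fin k) (Fin k) ℂ) (C : Matrix (Fin n) (Fin n) ℂ) :
    Prop :=
  ∃ X : Matrix (Fin n) (Fin k) ℂ, X.rank = k ∧ B = Xᴴ * C * X

theorem IsCompression.rank_le {n k : ℕ} {B : Matrix (Fin k) (Fin k) ℂ}
    {C : Matrix (Fin n) (Fin n) ℂ} (h : IsCompression B C) : B.rank ≤ C.rank := by
  obtain ⟨X, -, rfl⟩ := h
  exact (Matrix.rank_mul_le_left _ _).trans (Matrix.rank_mul_le_right _ _)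

theorem IsCompression.index_lt {n k : ℕ} {B : Matrix (Fin k) (Fin k) ℂ}
    {C : Matrix (Fin n) (Fin n) ℂ} (h : IsCompression B C) (j : Fin B.rank) :
    C.rank - B.rank + (j : ℕ) < C.rank := by
  have := h.rank_le
  have := j.isLt
  omega

end MatrixPhase

namespace MatrixPhase

open Module ComplexConjugate

/-! A matrix whose angular numerical range is not the plane has that range in a closed half-plane,
because the values of its quadratic form make a convex cone (Toeplitz–Hausdorff). Rotate the
half-plane to the right one and write `C = H + iK` with `H`, `K` Hermitian and `H` positive
semidefinite. Simultaneous reduction of the pair (`hasStdBasis`) then yields the decomposition `0 ⊕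
D ⊕ E`, so phases exist for any centre `a` whose half-plane contains the range
(`exists_hasPhasesAt`). A compression takes its values in the same half-plane, hence is
semi-sectorial and has phases with that same centre.

For a common centre `a` and `|α - a| < π/2`, the number of phases above `α` is the positive index of
inertia of the Hermitian form `x ↦ Im (e^{-iα} x*Cx)`, and the number below is the negative one.
Restriction to a subspace increases neither index (`card_phases_le`); this count at a midpoint
between two phases in the wrong order gives `interlace`.

Finally, two arbitrary selections may come from different centres. `HasPhasesAt.recenter` moves the
phases of the compression to the centre of `C` by shifts in `2πℤ`, and the condition on the phase
centers forces all shifts to vanish (`HasPhasesAt.of_abs_phaseCenter_sub_lt`). -/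

/-! ### Pairs of Hermitian forms and their standard bases. -/

/-- A sesquilinear form, conjugate-linear in the first argument. -/
abbrev SesqForm (V : Type*) [AddCommGroup V] [Module ℂ V] := V →ₗ⋆[ℂ] V →ₗ[ℂ] ℂ

/-- Hermitian symmetry of a sesquilinear form. -/
def SesqForm.IsHerm {V : Type*} [AddCommGroup V] [Module ℂ V] (h : SesqForm V) : Prop :=
  ∀ x y, conj (h x y) = h y x

/-- The standard form `0 ⊕ D ⊕ E`, with arbitrary index types and `θ₀ = 0`. -/
noncomputable def stdForm (Z M P : Type) [DecidableEq M] [DecidableEq P] (θ : M → ℝ) :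
    Matrix (Z ⊕ (M ⊕ (Fin 2 × P))) (Z ⊕ (M ⊕ (Fin 2 × P))) ℂ :=
  Matrix.fromBlocks 0 0 0
    (Matrix.fromBlocks
      (Matrix.diagonal fun k => Complex.exp ((θ k : ℂ) * Complex.I)) 0 0
      (Matrix.blockDiagonal fun _ : P => (!![1, 2; 0, 1] : Matrix (Fin 2) (Fin 2) ℂ)))

/-- The form `h + i k` is represented by a standard form in some basis. -/
def HasStdBasis {V : Type*} [AddCommGroup V] [Module ℂ V] (h k : SesqForm V) : Prop :=
  ∃ (Z M P : Type) (_ : Fintype Z) (_ : Fintype M) (_ : Fintype P) (_ : DecidableEq M)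
    (_ : DecidableEq P) (θ : M → ℝ) (b : Basis (Z ⊕ (M ⊕ (Fin 2 × P))) ℂ V),
    (∀ m, |θ m| ≤ Real.pi / 2) ∧
    ∀ i j, h (b i) (b j) + Complex.I * k (b i) (b j) = stdForm Z M P θ i j

/-! ### Splitting off a jointly orthogonal complement. -/

section extend

variable {V : Type*} [AddCommGroup V] [Module ℂ V] [FiniteDimensional ℂ V]

/-- Independence of the `α` vectors `G (u i)` in `ℂ^α` makes `G` bijective on the span of `u`, so
this span is a complement of `ker G`. -/
theorem exists_basis_extend {α ι : Type*} [Fintype α] [Fintype ι] (u : α → V)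
    (G : V →ₗ[ℂ] (α → ℂ)) (hu : LinearIndependent ℂ (fun i => G (u i)))
    (w : Basis ι ℂ (LinearMap.ker G)) :
    ∃ b : Basis (α ⊕ ι) ℂ V, (∀ i, b (Sum.inl i) = u i) ∧ ∀ j, b (Sum.inr j) = w j := by
  have hli : LinearIndependent ℂ (Sum.elim u (fun j => (w j : V))) := by
    refine LinearIndependent.sum_type (LinearIndependent.of_comp G hu) ?_ ?_
    · exact w.linearIndependent.map' (LinearMap.ker G).subtype (Submodule.ker_subtype _)
    · rw [Submodule.disjoint_def]
      intro x hx hx'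
      have hk : x ∈ LinearMap.ker G := by
        refine Submodule.span_le.2 ?_ hx'
        rintro _ ⟨j, rfl⟩
        exact (w j).2
      obtain ⟨c, rfl⟩ := (Submodule.mem_span_range_iff_exists_fun ℂ).1 hx
      rw [LinearMap.mem_ker, map_sum] at hk
      simp only [map_smul] at hk
      have := Fintype.linearIndependent_iff.1 hu c hk
      simp [this]
  have hsurj : LinearMap.range G = ⊤ := by
    rw [eq_top_iff, ← hu.span_eq_top_of_card_eq_finrank' (by simp), Submodule.span_le]
    rintro _ ⟨i, rfl⟩
    exact ⟨_, rfl⟩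
  have hcard : Fintype.card (α ⊕ ι) = finrank ℂ V := by
    rw [← LinearMap.finrank_range_add_finrank_ker G, hsurj, finrank_top,
      Fintype.card_sum, finrank_eq_card_basis w]
    simp
  have hspan := hli.span_eq_top_of_card_eq_finrank' hcard
  exact ⟨Basis.mk hli hspan.ge, fun i => by simp, fun j => by simp⟩

variable {h k : SesqForm V} (hh : h.IsHerm) (hk : k.IsHerm)

-- `ker G` serves as a complement orthogonal to `u` for both forms at once, so the Gram matrices
-- become block diagonal and an induction can continue on `ker G`.
include hh hk in
theorem extend_aux {α ι : Type*} [Fintype α] [Fintype ι] (u : α → V)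
    (G : V →ₗ[ℂ] (α → ℂ)) (hu : LinearIndependent ℂ (fun i => G (u i)))
    (hG : ∀ v ∈ LinearMap.ker G, ∀ i, h (u i) v = 0 ∧ k (u i) v = 0)
    (w : Basis ι ℂ (LinearMap.ker G)) :
    ∃ b : Basis (α ⊕ ι) ℂ V,
      (∀ i, b (Sum.inl i) = u i) ∧ (∀ j, b (Sum.inr j) = w j) ∧
      (∀ i j, h (b (Sum.inl i)) (b (Sum.inr j)) = 0) ∧
      (∀ i j, k (b (Sum.inl i)) (b (Sum.inr j)) = 0) ∧
      (∀ i j, h (b (Sum.inr j)) (b (Sum.inl i)) = 0) ∧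
      (∀ i j, k (b (Sum.inr j)) (b (Sum.inl i)) = 0) := by
  obtain ⟨b, hb1, hb2⟩ := exists_basis_extend u G hu w
  have h1 : ∀ i j, h (b (Sum.inl i)) (b (Sum.inr j)) = 0 := fun i j => by
    rw [hb1, hb2]; exact (hG _ (w j).2 i).1
  have k1 : ∀ i j, k (b (Sum.inl i)) (b (Sum.inr j)) = 0 := fun i j => by
    rw [hb1, hb2]; exact (hG _ (w j).2 i).2
  refine ⟨b, hb1, hb2, h1, k1, fun i j => ?_, fun i j => ?_⟩
  · rw [← hh, h1, map_zero]
  · rw [← hk, k1, map_zero]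

end extend

section step

variable {V : Type*} [AddCommGroup V] [Module ℂ V] [FiniteDimensional ℂ V]
variable {h k : SesqForm V} (hh : h.IsHerm) (hk : k.IsHerm)

/-- Moves a one-point summand into the first block. -/
def zeroEquiv (Z M P : Type) :
    Unit ⊕ (Z ⊕ (M ⊕ (Fin 2 × P))) ≃ (Unit ⊕ Z) ⊕ (M ⊕ (Fin 2 × P)) :=
  (Equiv.sumAssoc _ _ _).symm

/-- Moves a one-point summand into the diagonal block. -/
def diagEquiv (Z M P : Type) :
    Unit ⊕ (Z ⊕ (M ⊕ (Fin 2 × P))) ≃ Z ⊕ ((Unit ⊕ M) ⊕ (Fin 2 × P)) where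
  toFun := Sum.elim (fun a => .inr (.inl (.inl a)))
    (Sum.elim .inl (Sum.elim (fun m => .inr (.inl (.inr m))) (fun q => .inr (.inr q))))
  invFun := Sum.elim (fun z => .inr (.inl z))
    (Sum.elim (Sum.elim .inl (fun m => .inr (.inr (.inl m)))) (fun q => .inr (.inr (.inr q))))
  left_inv := by rintro (a | z | m | q) <;> rfl
  right_inv := by rintro (z | (a | m) | q) <;> rfl

/-- Moves a two-point summand into the last block. -/
def blockEquiv (Z M P : Type) :
    Fin 2 ⊕ (Z ⊕ (M ⊕ (Fin 2 × P))) ≃ Z ⊕ (M ⊕ (Fin 2 × (Unit ⊕ P))) where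
  toFun := Sum.elim (fun a => .inr (.inr (a, .inl ())))
    (Sum.elim .inl (Sum.elim (fun m => .inr (.inl m)) (fun q => .inr (.inr (q.1, .inr q.2)))))
  invFun := Sum.elim (fun z => .inr (.inl z))
    (Sum.elim (fun m => .inr (.inr (.inl m)))
      (fun q => Sum.elim (fun _ => .inl q.1) (fun p => .inr (.inr (.inr (q.1, p)))) q.2))
  left_inv := by rintro (a | z | m | q) <;> rfl
  right_inv := by rintro (z | m | ⟨a, (_ | p)⟩) <;> rfl

-- Since `x` is in the radical of both forms, any complement of it is orthogonal to it; `G` merely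
-- picks one.
include hh hk in
theorem HasStdBasis.extend_zero (x : V) (G : V →ₗ[ℂ] (Unit → ℂ)) (hx : G x ≠ 0)
    (h0 : ∀ v, h x v = 0) (k0 : ∀ v, k x v = 0)
    (H : HasStdBasis (h.domRestrict₁₂ (LinearMap.ker G) (LinearMap.ker G))
      (k.domRestrict₁₂ (LinearMap.ker G) (LinearMap.ker G))) : HasStdBasis h k := by
  obtain ⟨Z, M, P, _, _, _, _, _, θ, w, hθ, hw⟩ := H
  obtain ⟨b, hb1, hb2, h1, k1, h2, k2⟩ := extend_aux hh hk (fun _ : Unit => x) G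
    (by simpa using hx) (fun v _ _ => ⟨h0 v, k0 v⟩) w
  refine ⟨Unit ⊕ Z, M, P, inferInstance, inferInstance, inferInstance, inferInstance,
    inferInstance, θ, b.reindex (zeroEquiv Z M P), hθ, fun i j => ?_⟩
  obtain ⟨i, rfl⟩ := (zeroEquiv Z M P).surjective i
  obtain ⟨j, rfl⟩ := (zeroEquiv Z M P).surjective j
  simp only [Basis.reindex_apply, Equiv.symm_apply_apply]
  rcases i with i | i <;> rcases j with j | j
  · rw [hb1, h0, k0]; simp [zeroEquiv, stdForm]
  · rw [h1, k1]; rcases j with j | j <;> simp [zeroEquiv, stdForm]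
  · rw [h2, k2]; rcases i with i | i <;> simp [zeroEquiv, stdForm]
  · have := hw i j
    simp only [LinearMap.domRestrict₁₂_apply] at this
    rw [hb2, hb2, this]
    rcases i with i | i | i <;> rcases j with j | j | j <;> simp [zeroEquiv, stdForm]

include hh hk in
theorem HasStdBasis.extend_diag (x : V) (G : V →ₗ[ℂ] (Unit → ℂ)) (hx : G x ≠ 0) (t : ℝ)
    (ht : |t| ≤ Real.pi / 2)
    (hG : ∀ v ∈ LinearMap.ker G, h x v = 0 ∧ k x v = 0)
    (hf : h x x + Complex.I * k x x = Complex.exp (t * Complex.I))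
    (H : HasStdBasis (h.domRestrict₁₂ (LinearMap.ker G) (LinearMap.ker G))
      (k.domRestrict₁₂ (LinearMap.ker G) (LinearMap.ker G))) : HasStdBasis h k := by
  obtain ⟨Z, M, P, _, _, _, _, _, θ, w, hθ, hw⟩ := H
  obtain ⟨b, hb1, hb2, h1, k1, h2, k2⟩ := extend_aux hh hk (fun _ : Unit => x) G
    (by simpa using hx) (fun v hv _ => hG v hv) w
  refine ⟨Z, Unit ⊕ M, P, inferInstance, inferInstance, inferInstance, inferInstance,
    inferInstance, Sum.elim (fun _ => t) θ, b.reindex (diagEquiv Z M P), ?_, fun i j => ?_⟩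
  · rintro (_ | m)
    · exact ht
    · exact hθ m
  obtain ⟨i, rfl⟩ := (diagEquiv Z M P).surjective i
  obtain ⟨j, rfl⟩ := (diagEquiv Z M P).surjective j
  simp only [Basis.reindex_apply, Equiv.symm_apply_apply]
  rcases i with i | i <;> rcases j with j | j
  · rw [hb1, hf]; simp [diagEquiv, stdForm]
  · rw [h1, k1]; rcases j with j | j | j <;> simp [diagEquiv, stdForm]
  · rw [h2, k2]; rcases i with i | i | i <;> simp [diagEquiv, stdForm]
  · have := hw i j
    simp only [LinearMap.domRestrict₁₂_apply] at this
    rw [hb2, hb2, this]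
    rcases i with i | i | i <;> rcases j with j | j | j <;>
      simp [diagEquiv, stdForm, Matrix.diagonal_apply]

include hh hk in
theorem HasStdBasis.extend_block (u : Fin 2 → V) (G : V →ₗ[ℂ] (Fin 2 → ℂ))
    (hu : LinearIndependent ℂ (fun i => G (u i)))
    (hG : ∀ v ∈ LinearMap.ker G, ∀ i, h (u i) v = 0 ∧ k (u i) v = 0)
    (hf : ∀ i j, h (u i) (u j) + Complex.I * k (u i) (u j) =
      (!![1, 2; 0, 1] : Matrix (Fin 2) (Fin 2) ℂ) i j)
    (H : HasStdBasis (h.domRestrict₁₂ (LinearMap.ker G) (LinearMap.ker G))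
      (k.domRestrict₁₂ (LinearMap.ker G) (LinearMap.ker G))) : HasStdBasis h k := by
  obtain ⟨Z, M, P, _, _, _, _, _, θ, w, hθ, hw⟩ := H
  obtain ⟨b, hb1, hb2, h1, k1, h2, k2⟩ := extend_aux hh hk u G hu hG w
  refine ⟨Z, M, Unit ⊕ P, inferInstance, inferInstance, inferInstance, inferInstance,
    inferInstance, θ, b.reindex (blockEquiv Z M P), hθ, fun i j => ?_⟩
  obtain ⟨i, rfl⟩ := (blockEquiv Z M P).surjective i
  obtain ⟨j, rfl⟩ := (blockEquiv Z M P).surjective j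
  simp only [Basis.reindex_apply, Equiv.symm_apply_apply]
  rcases i with i | i <;> rcases j with j | j
  · rw [hb1, hb1, hf]; simp [blockEquiv, stdForm, Matrix.blockDiagonal_apply]
  · rw [h1, k1]
    rcases j with j | j | j <;> simp [blockEquiv, stdForm, Matrix.blockDiagonal_apply]
  · rw [h2, k2]
    rcases i with i | i | i <;> simp [blockEquiv, stdForm, Matrix.blockDiagonal_apply]
  · have := hw i j
    simp only [LinearMap.domRestrict₁₂_apply] at this
    rw [hb2, hb2, this]
    rcases i with i | i | i <;> rcases j with j | j | j <;>
      simp [blockEquiv, stdForm, Matrix.blockDiagonal_apply]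

end step

/-! ### Positive semidefinite forms and representation of functionals. -/

section psd

variable {V : Type*} [AddCommGroup V] [Module ℂ V] {h k : SesqForm V}

theorem SesqForm.IsHerm.self_re (hh : h.IsHerm) (x : V) : h x x = ((h x x).re : ℂ) :=
  (Complex.conj_eq_iff_re.1 (hh x x)).symm

/-- A null vector of a positive semidefinite form lies in its kernel. -/
theorem SesqForm.IsHerm.apply_eq_zero_of_self (hh : h.IsHerm) (hp : ∀ x, 0 ≤ (h x x).re) {x : V}
    (hx : (h x x).re = 0) (y : V) : h y x = 0 := by
  by_contra hne
  set c := h y x with hc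
  have hcc : h x y = conj c := by rw [hc, hh]
  have hpos : 0 < Complex.normSq c := Complex.normSq_pos.2 hne
  -- Positivity at `x - t c y`; the term linear in `t` is negative for `t > 0`, so a small `t` gives
  -- a contradiction.
  have key : ∀ t : ℝ, 0 ≤ -2 * t * Complex.normSq c
      + t ^ 2 * Complex.normSq c * (h y y).re := by
    intro t
    have := hp (x - ((t : ℂ) * c) • y)
    have e : h (x - ((t : ℂ) * c) • y) (x - ((t : ℂ) * c) • y)
        = h x x - t * (Complex.normSq c) - t * (Complex.normSq c)
          + t ^ 2 * (Complex.normSq c) * h y y := by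
      simp only [map_sub, LinearMap.sub_apply, LinearMap.map_smulₛₗ, map_smul,
        LinearMap.smul_apply, smul_eq_mul, map_mul, Complex.conj_ofReal, ← hc, hcc,
        Complex.normSq_eq_conj_mul_self]
      ring
    rw [e, hh.self_re x, hh.self_re y, hx] at this
    norm_cast at this
    linarith
  have hy := hp y
  -- With `t = 1 / (h y y + 1)` one has `t * h y y < 1`, so the linear term dominates.
  have h1 := key (1 / ((h y y).re + 1))
  have hy1 : 0 < (h y y).re + 1 := by linarith
  have : -2 * (1 / ((h y y).re + 1)) * Complex.normSq c
      + (1 / ((h y y).re + 1)) ^ 2 * Complex.normSq c * (h y y).re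
      = - (Complex.normSq c * ((h y y).re + 2)) / ((h y y).re + 1) ^ 2 := by
    field_simp; ring
  rw [this] at h1
  have : 0 < Complex.normSq c * ((h y y).re + 2) / ((h y y).re + 1) ^ 2 := by positivity
  rw [neg_div] at h1
  linarith

/-- A sesquilinear form vanishing on the diagonal of a subspace vanishes on the subspace. -/
theorem SesqForm.apply_eq_zero_of_diag (N : Submodule ℂ V)
    (hN : ∀ x ∈ N, k x x = 0) {x y : V} (hx : x ∈ N) (hy : y ∈ N) : k x y = 0 := by
  have h1 := hN _ (N.add_mem hx hy)
  have h2 := hN _ (N.add_mem hx (N.smul_mem Complex.I hy))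
  simp only [map_add, LinearMap.add_apply, LinearMap.map_smulₛₗ, map_smul, LinearMap.smul_apply,
    smul_eq_mul, hN x hx, hN y hy, Complex.conj_I] at h1 h2
  have h3 : k y x = - k x y := by linear_combination h1
  rw [h3] at h2
  have : 2 * Complex.I * k x y = 0 := by linear_combination h2
  simpa using this

variable [FiniteDimensional ℂ V]

/-- A definite Hermitian form represents every other sesquilinear form by an operator. -/
theorem exists_operator (hd : ∀ x, (∀ v, h v x = 0) → x = 0) :
    ∃ A : V →ₗ[ℂ] V, ∀ v x, h v (A x) = k v x := by
  let e := Module.finBasis ℂ V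
  let Hm : SesqForm V → V →ₗ[ℂ] (Fin (finrank ℂ V) → ℂ) := fun f => LinearMap.pi fun i => f (e i)
  have hinj : Function.Injective (Hm h) := by
    rw [← LinearMap.ker_eq_bot, Submodule.eq_bot_iff]
    intro x hx
    refine hd x fun v => ?_
    have : h.flip x = 0 := e.ext fun i => congrFun hx i
    simpa using congrArg (fun f => f v) this
  let E := LinearMap.linearEquivOfInjective (Hm h) hinj (by simp)
  refine ⟨E.symm.toLinearMap ∘ₗ Hm k, fun v x => ?_⟩
  have h1 : Hm h (E.symm (Hm k x)) = Hm k x := E.apply_symm_apply _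
  have : h.flip (E.symm (Hm k x)) = k.flip x := e.ext fun i => congrFun h1 i
  simpa using congrArg (fun f => f v) this

/-- If the functional `k · x` vanishes on the kernel of `h`, it is represented by `h`. -/
theorem exists_representer (hh : h.IsHerm) (hp : ∀ x, 0 ≤ (h x x).re) (x : V)
    (hx : ∀ v, (∀ w, h w v = 0) → k v x = 0) : ∃ y, ∀ v, h v y = k v x := by
  let N : Submodule ℂ V := LinearMap.ker h.flip
  have hN : ∀ v, v ∈ N ↔ ∀ w, h w v = 0 := fun v => by
    simp only [N, LinearMap.mem_ker]
    exact ⟨fun hv w => by simpa using congrArg (fun f => f w) hv,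
      fun hv => LinearMap.ext fun w => by simpa using hv w⟩
  -- On a complement of the radical `N` the form `h` is definite, so it represents every functional
  -- there; on `N` both sides vanish by `hx`.
  obtain ⟨N', hc⟩ := N.exists_isCompl
  let e := Module.finBasis ℂ N'
  let Hm : N' →ₗ[ℂ] (Fin (finrank ℂ N') → ℂ) :=
    LinearMap.pi fun i => (h (e i)).comp N'.subtype
  have hinj : Function.Injective Hm := by
    rw [← LinearMap.ker_eq_bot, Submodule.eq_bot_iff]
    intro v hv
    have hv0 : (h.flip v).comp N'.subtype = 0 := e.ext fun i => congrFun hv i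
    have hvv : h v v = 0 := by simpa using congrArg (fun f => f v) hv0
    have : (v : V) ∈ N := (hN _).2 (hh.apply_eq_zero_of_self hp (by rw [hvv]; rfl))
    exact Subtype.ext (Submodule.disjoint_def.1 hc.disjoint _ this v.2)
  let E := LinearMap.linearEquivOfInjective Hm hinj (by simp)
  set y := E.symm (fun i => k (e i) x) with hy
  have h1 : Hm y = fun i => k (e i) x := E.apply_symm_apply _
  have h2 : (h.flip y).comp N'.subtype = (k.flip x).comp N'.subtype :=
    e.ext fun i => congrFun h1 i
  refine ⟨y, fun v => ?_⟩
  have hv : v ∈ N ⊔ N' := by rw [hc.sup_eq_top]; trivial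
  obtain ⟨a, ha, b, hb, rfl⟩ := Submodule.mem_sup.1 hv
  have ha1 : h a y = 0 := by rw [← hh, (hN a).1 ha, map_zero]
  have hb1 : h b y = k b x := by simpa using congrArg (fun f => f ⟨b, hb⟩) h2
  simp [ha1, hb1, hx a ((hN a).1 ha)]

end psd

/-! ### Simultaneous canonical form of a Hermitian pair. -/

/-- Induction on the dimension, with `N` the radical of `h`. A vector of `N` with `k x x ≠ 0` gives
a phase `±π/2`. Otherwise `k` vanishes on `N × N`; if some `x ∈ N` still pairs with a vector outside
`N`, a plane containing `x` gives a block `[1 2; 0 1]`. If `N` is in the radical of `k`, it gives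
zero rows. If `N = 0`, the form `h` is definite and an eigenvector of `h⁻¹k` gives a phase in the
open interval. -/
theorem hasStdBasis_aux (d : ℕ) : ∀ (V : Type) [AddCommGroup V] [Module ℂ V]
    [FiniteDimensional ℂ V] (h k : SesqForm V), finrank ℂ V = d → h.IsHerm → k.IsHerm →
    (∀ x, 0 ≤ (h x x).re) → HasStdBasis h k := by
  induction d using Nat.strong_induction_on with
  | _ d ih =>
  intro V _ _ _ h k hd hh hk hp
  have IH : ∀ (α : Type) [Fintype α] (G : V →ₗ[ℂ] (α → ℂ)), G ≠ 0 →
      HasStdBasis (h.domRestrict₁₂ (LinearMap.ker G) (LinearMap.ker G))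
      (k.domRestrict₁₂ (LinearMap.ker G) (LinearMap.ker G)) := by
    intro α _ G hG
    refine ih (finrank ℂ (LinearMap.ker G)) ?_ _ _ _ rfl (fun x y => hh x y) (fun x y => hk x y)
      (fun x => hp x)
    rw [← hd]
    exact Submodule.finrank_lt (fun hk => hG (LinearMap.ker_eq_top.1 hk))
  have IH1 : ∀ (x : V) (G : V →ₗ[ℂ] (Unit → ℂ)), G x ≠ 0 →
      HasStdBasis (h.domRestrict₁₂ (LinearMap.ker G) (LinearMap.ker G))
      (k.domRestrict₁₂ (LinearMap.ker G) (LinearMap.ker G)) :=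
    fun x G hx => IH Unit G fun h0 => hx (by simp [h0])
  have hflip : ∀ x, (∀ v, h v x = 0) → ∀ v, h x v = 0 := fun x hx v => by
    rw [← hh, hx, map_zero]
  by_cases c1 : ∃ x, (∀ v, h v x = 0) ∧ k x x ≠ 0
  · obtain ⟨x, hx, hkx⟩ := c1
    obtain ⟨r, hr⟩ : ∃ r : ℝ, k x x = r := ⟨_, hk.self_re x⟩
    have hr0 : r ≠ 0 := by rintro rfl; simp [hr] at hkx
    set s : ℝ := 1 / Real.sqrt |r| with hs
    have hs0 : s ≠ 0 := by simp [hs, hr0]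
    have hs2 : s * s * |r| = 1 := by
      have := Real.mul_self_sqrt (abs_nonneg r)
      have h0 : Real.sqrt |r| ≠ 0 := by simp [hr0]
      rw [hs]; field_simp; rw [sq, this]
    let G : V →ₗ[ℂ] (Unit → ℂ) := LinearMap.pi fun _ => k x
    have hGx : G ((s : ℂ) • x) ≠ 0 := fun h0 => by
      have := congrFun h0 ()
      simp [G, hs0, hkx] at this
    refine HasStdBasis.extend_diag hh hk ((s : ℂ) • x) G hGx
      (if 0 < r then Real.pi / 2 else -(Real.pi / 2)) ?_ ?_ ?_ (IH1 _ G hGx)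
    · have := Real.pi_pos
      split_ifs <;> rw [abs_le] <;> constructor <;> linarith
    · intro v hv
      have : k x v = 0 := congrFun hv ()
      simp [-Complex.coe_smul, hflip x hx, this]
    · have e : h ((s : ℂ) • x) ((s : ℂ) • x) + Complex.I * k ((s : ℂ) • x) ((s : ℂ) • x)
          = ((s * s * r : ℝ) : ℂ) * Complex.I := by
        simp [-Complex.coe_smul, hx, hr]; ring
      rw [e]
      split_ifs with hpos
      · rw [abs_of_pos hpos] at hs2
        rw [hs2]; simp [Complex.exp_pi_div_two_mul_I]
      · rw [abs_of_nonpos (not_lt.1 hpos)] at hs2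
        have : s * s * r = -1 := by linarith
        rw [this]
        have h2 := Complex.exp_neg_pi_div_two_mul_I
        push_cast
        rw [← neg_div, h2]; simp
  push Not at c1
  let N : Submodule ℂ V := LinearMap.ker h.flip
  have hN : ∀ v, v ∈ N ↔ ∀ w, h w v = 0 := fun v => by
    simp only [N, LinearMap.mem_ker]
    exact ⟨fun hv w => by simpa using congrArg (fun f => f w) hv,
      fun hv => LinearMap.ext fun w => by simpa using hv w⟩
  have hkN : ∀ x ∈ N, ∀ y ∈ N, k x y = 0 := fun x hx y hy =>
    SesqForm.apply_eq_zero_of_diag N (fun x hx => c1 x ((hN x).1 hx)) hx hy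
  by_cases c2 : ∃ x ∈ N, ∃ v, k x v ≠ 0
  · obtain ⟨x, hx, v₀, hv₀⟩ := c2
    -- The partner of `x` is the vector representing `k · x` through `h`; then `c = h y' y' = k y'
    -- x`, which is positive because otherwise `k · x` would vanish.
    obtain ⟨y', hy'⟩ := exists_representer (k := k) hh hp x
      (fun v hv => hkN v ((hN v).2 hv) x hx)
    have hxx : k x x = 0 := hkN x hx x hx
    obtain ⟨c, hc⟩ : ∃ c : ℝ, h y' y' = c := ⟨_, hh.self_re y'⟩
    have hkyx' : k y' x = c := by rw [← hy', hc]
    have hkxy' : k x y' = c := by rw [← hk, hkyx', Complex.conj_ofReal]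
    have hc0 : 0 < c := by
      have h0 : 0 ≤ c := by have := hp y'; rwa [hc] at this
      refine lt_of_le_of_ne h0 fun hc' => hv₀ ?_
      have : (h y' y').re = 0 := by rw [hc, ← hc']; rfl
      rw [← hk, ← hy', hh.apply_eq_zero_of_self hp this, map_zero]
    obtain ⟨q, hq⟩ : ∃ q : ℝ, k y' y' = q := ⟨_, hk.self_re y'⟩
    -- Adding a multiple of `x` leaves `h · y'` unchanged and shifts `k y' y' = q` by `2tc`; this
    -- `t` makes it zero.
    set t : ℝ := -q / (2 * c) with ht
    set y := y' + (t : ℂ) • x with hydef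
    have hvx : ∀ v, h v x = 0 := (hN x).1 hx
    have hxv : ∀ v, h x v = 0 := hflip x hvx
    have hy : ∀ v, h v y = k v x := fun v => by simp [-Complex.coe_smul, hydef, hvx, hy']
    have hyl : ∀ v, h y v = k x v := fun v => by rw [← hh, hy, hk]
    have hkyx : k y x = c := by simp [-Complex.coe_smul, hydef, hkyx', hxx]
    have hkxy : k x y = c := by rw [← hk, hkyx, Complex.conj_ofReal]
    have hyy : k y y = 0 := by
      have : q + t * c + t * c = 0 := by rw [ht]; field_simp; ring
      simp only [hydef, map_add, LinearMap.add_apply, LinearMap.map_smulₛₗ, map_smul,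
        LinearMap.smul_apply, smul_eq_mul, Complex.conj_ofReal, hq, hkyx', hkxy', hxx]
      norm_cast
      linarith
    set s : ℝ := 1 / Real.sqrt c with hs
    have hs0 : s ≠ 0 := by simp [hs, hc0.ne', Real.sqrt_eq_zero hc0.le]
    have hs2 : (s : ℂ) * s * c = 1 := by
      have h1 := Real.mul_self_sqrt hc0.le
      have h0 : Real.sqrt c ≠ 0 := by simp [Real.sqrt_eq_zero hc0.le, hc0.ne']
      have : s * s * c = 1 := by rw [hs]; field_simp; rw [sq, h1]
      exact_mod_cast this
    -- In this basis `h` has all entries `1` and `k` is `[0 -i; i 0]`, the Hermitian and skew parts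
    -- of `[1 2; 0 1]`.
    let u : Fin 2 → V := ![(s : ℂ) • y + (Complex.I * s / 2) • x,
      (s : ℂ) • y - (Complex.I * s / 2) • x]
    -- Orthogonality for `k` suffices: `h x` is zero and `h y = k x`.
    let G : V →ₗ[ℂ] (Fin 2 → ℂ) := LinearMap.pi ![k x, k y]
    have hsC : (s : ℂ) ≠ 0 := by exact_mod_cast hs0
    have hcC : (c : ℂ) ≠ 0 := by exact_mod_cast hc0.ne'
    have hli : LinearIndependent ℂ (fun i => G (u i)) := by
      rw [Fintype.linearIndependent_iff]
      intro g hg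
      have h0 := congrFun hg 0
      have h1 := congrFun hg 1
      simp [-Complex.coe_smul, G, u, hkxy, hkyx, hxx, hyy, Fin.sum_univ_two] at h0 h1
      have e0 : g 0 + g 1 = 0 := by
        have : (s * c : ℂ) * (g 0 + g 1) = 0 := by linear_combination h0
        simpa [hsC, hcC] using this
      have e1 : g 0 - g 1 = 0 := by
        have : (Complex.I * s / 2 * c : ℂ) * (g 0 - g 1) = 0 := by linear_combination h1
        simpa [hsC, hcC] using this
      intro i
      fin_cases i
      · show g 0 = 0
        linear_combination (e0 + e1) / 2
      · show g 1 = 0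
        linear_combination (e0 - e1) / 2
    have hG0 : G ≠ 0 := fun h0 => by
      have := hli.ne_zero 0
      simp [h0] at this
    refine HasStdBasis.extend_block hh hk u G hli ?_ ?_ (IH (Fin 2) G hG0)
    · intro v hv i
      have h0 : k x v = 0 := congrFun hv 0
      have h1 : k y v = 0 := congrFun hv 1
      fin_cases i <;> simp [-Complex.coe_smul, u, hyl, hxv, h0, h1]
    · have hI := Complex.I_mul_I
      intro i j
      fin_cases i <;> fin_cases j <;>
        simp [-Complex.coe_smul, u, hyl, hxv, hkxy, hkyx, hxx, hyy, map_ofNat]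
      · linear_combination hs2
      · linear_combination hs2 - s * s * c * hI + hs2
      · linear_combination hs2 + s * s * c * hI - hs2
      · linear_combination hs2
  push Not at c2
  by_cases c3 : ∃ x ∈ N, x ≠ 0
  · obtain ⟨x, hx, hx0⟩ := c3
    obtain ⟨f, hf⟩ : ∃ f : Module.Dual ℂ V, f x ≠ 0 := by
      by_contra! hcon
      exact hx0 ((forall_dual_apply_eq_zero_iff ℂ x).1 hcon)
    have hGx : LinearMap.pi (fun _ : Unit => f) x ≠ 0 := fun h0 => hf (congrFun h0 ())
    exact HasStdBasis.extend_zero hh hk x _ hGx (hflip x ((hN x).1 hx)) (c2 x hx) (IH1 x _ hGx)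
  push Not at c3
  rcases subsingleton_or_nontrivial V with hV | hV
  · refine ⟨Empty, Empty, Empty, inferInstance, inferInstance, inferInstance, inferInstance,
      inferInstance, Empty.elim, Basis.empty V, fun m => m.elim, fun i => ?_⟩
    exact isEmptyElim i
  · obtain ⟨A, hA⟩ := exists_operator (h := h) (k := k) fun x hx => c3 x ((hN x).2 hx)
    obtain ⟨l, hl⟩ := Module.End.exists_eigenvalue A
    obtain ⟨x, hx⟩ := hl.exists_hasEigenvector
    have hkx : ∀ v, k v x = l * h v x := fun v => by
      rw [← hA, hx.apply_eq_smul]; simp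
    obtain ⟨c, hc⟩ : ∃ c : ℝ, h x x = c := ⟨_, hh.self_re x⟩
    have hc0 : 0 < c := by
      have h0 : 0 ≤ c := by have := hp x; rwa [hc] at this
      refine lt_of_le_of_ne h0 fun hc' => hx.2 (c3 x ((hN x).2 ?_))
      exact hh.apply_eq_zero_of_self hp (by rw [hc, ← hc']; rfl)
    have hcC : (c : ℂ) ≠ 0 := by exact_mod_cast hc0.ne'
    have hlr : conj l = l := by
      have := hk x x
      rw [hkx, hc, map_mul, Complex.conj_ofReal] at this
      exact mul_right_cancel₀ hcC this
    obtain ⟨r, rfl⟩ := Complex.conj_eq_iff_real.1 hlr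
    have hxk : ∀ v, k x v = r * h x v := fun v => by
      rw [← hk, hkx, map_mul, hh, Complex.conj_ofReal]
    -- The value of `h + ik` at the eigenvector, with positive real part; its argument is the phase,
    -- and `s` scales its modulus to `1`.
    set z : ℂ := c * (1 + r * Complex.I) with hz
    have hzre : z.re = c := by simp [hz]
    have hz0 : z ≠ 0 := fun h0 => by rw [h0] at hzre; simp at hzre; linarith
    have hzn : 0 < ‖z‖ := norm_pos_iff.2 hz0
    set s : ℝ := 1 / Real.sqrt ‖z‖ with hs
    have hsq : Real.sqrt ‖z‖ ≠ 0 := by simp [Real.sqrt_eq_zero hzn.le, hz0]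
    have hs0 : s ≠ 0 := by rw [hs]; exact one_div_ne_zero hsq
    have hs2 : (s : ℂ) * s * ‖z‖ = 1 := by
      have h1 := Real.mul_self_sqrt hzn.le
      have : s * s * ‖z‖ = 1 := by rw [hs]; field_simp; rw [sq, h1]
      exact_mod_cast this
    let G : V →ₗ[ℂ] (Unit → ℂ) := LinearMap.pi fun _ => h x
    have hGx : G ((s : ℂ) • x) ≠ 0 := fun h0 => by
      have := congrFun h0 ()
      simp [G, hs0, hc, hcC] at this
    refine HasStdBasis.extend_diag hh hk ((s : ℂ) • x) G hGx z.arg ?_ ?_ ?_ (IH1 _ G hGx)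
    · exact Complex.abs_arg_le_pi_div_two_iff.2 (by rw [hzre]; exact hc0.le)
    · intro v hv
      have : h x v = 0 := congrFun hv ()
      simp [-Complex.coe_smul, hxk, this]
    · have e : h ((s : ℂ) • x) ((s : ℂ) • x) + Complex.I * k ((s : ℂ) • x) ((s : ℂ) • x)
          = s * s * z := by
        simp [-Complex.coe_smul, hxk, hc, hz]; ring
      rw [e]
      conv_lhs => rw [← Complex.norm_mul_exp_arg_mul_I z]
      rw [← mul_assoc, hs2, one_mul]

/-- Simultaneous canonical form of two Hermitian forms, the first one positive semidefinite. -/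
theorem hasStdBasis {V : Type} [AddCommGroup V] [Module ℂ V] [FiniteDimensional ℂ V]
    {h k : SesqForm V} (hh : h.IsHerm) (hk : k.IsHerm) (hp : ∀ x, 0 ≤ (h x x).re) :
    HasStdBasis h k :=
  hasStdBasis_aux _ V h k rfl hh hk hp

/-! ### Phases with a prescribed centre and their existence. -/

/-- `φ` lists, in any order and indexed by any type, the phases of a generalized sectorial
decomposition of `C` with central direction `θ₀`. -/
def HasPhasesAt {n : ℕ} (C : Matrix (Fin n) (Fin n) ℂ) (θ₀ : ℝ) {J : Type} (φ : J → ℝ) : Prop :=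
  ∃ (z m p : ℕ) (e : (Fin z ⊕ (Fin m ⊕ (Fin 2 × Fin p))) ≃ Fin n)
    (θ : Fin m → ℝ) (T : Matrix (Fin n) (Fin n) ℂ) (σ : J ≃ (Fin m ⊕ (Fin p ⊕ Fin p))),
    (∀ k, θ₀ - Real.pi / 2 ≤ θ k ∧ θ k ≤ θ₀ + Real.pi / 2) ∧
    IsUnit T.det ∧
    C = Tᴴ * Matrix.reindex e e (gsdMiddle z m p θ₀ θ) * T ∧
    ∀ j, φ j = Sum.elim θ
      (Sum.elim (fun _ => θ₀ + Real.pi / 2) (fun _ => θ₀ - Real.pi / 2)) (σ j)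

theorem isPhases_iff {n : ℕ} {C : Matrix (Fin n) (Fin n) ℂ} {φ : Fin C.rank → ℝ} :
    IsPhases C φ ↔ Antitone φ ∧ ∃ θ₀, HasPhasesAt C θ₀ φ := by
  constructor
  · rintro ⟨h, z, m, p, e, θ₀, θ, T, σ, H⟩
    exact ⟨h, θ₀, z, m, p, e, θ, T, σ, H⟩
  · rintro ⟨h, θ₀, z, m, p, e, θ, T, σ, H⟩
    exact ⟨h, z, m, p, e, θ₀, θ, T, σ, H⟩

theorem HasPhasesAt.comp_equiv {n : ℕ} {C : Matrix (Fin n) (Fin n) ℂ} {θ₀ : ℝ} {J J' : Type}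
    {φ : J → ℝ} (h : HasPhasesAt C θ₀ φ) (τ : J' ≃ J) : HasPhasesAt C θ₀ (φ ∘ τ) := by
  obtain ⟨z, m, p, e, θ, T, σ, h1, h2, h3, h4⟩ := h
  exact ⟨z, m, p, e, θ, T, τ.trans σ, h1, h2, h3, fun j => h4 (τ j)⟩

theorem rank_fromBlocks_zero_zero_zero {α β : Type*} [Fintype α] [Fintype β] [DecidableEq α]
    [DecidableEq β] (A : Matrix β β ℂ) :
    (Matrix.fromBlocks (0 : Matrix α α ℂ) 0 0 A).rank = A.rank := by
  let R : Matrix β (α ⊕ β) ℂ := Matrix.fromCols 0 1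
  have h1 : Rᵀ * A * R = Matrix.fromBlocks 0 0 0 A := by
    ext (i | i) (j | j) <;> simp [R, Matrix.mul_apply, Matrix.one_apply]
  have h2 : R * Matrix.fromBlocks (0 : Matrix α α ℂ) 0 0 A * Rᵀ = A := by
    ext i j
    simp [R, Matrix.mul_apply, Matrix.one_apply]
  apply le_antisymm
  · rw [← h1]
    exact (Matrix.rank_mul_le_left _ _).trans (Matrix.rank_mul_le_right _ _)
  · conv_lhs => rw [← h2]
    exact (Matrix.rank_mul_le_left _ _).trans (Matrix.rank_mul_le_right _ _)

/-- `D` and `E` are invertible. This makes the number of listed phases equal to `C.rank`. -/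
theorem rank_gsdMiddle (z m p : ℕ) (θ₀ : ℝ) (θ : Fin m → ℝ) :
    (gsdMiddle z m p θ₀ θ).rank = m + (p + p) := by
  rw [gsdMiddle, rank_fromBlocks_zero_zero_zero, Matrix.rank_of_isUnit]
  · simp; ring
  · rw [Matrix.isUnit_iff_isUnit_det, Matrix.det_fromBlocks_zero₂₁, Matrix.det_diagonal,
      Matrix.det_blockDiagonal]
    simp [Matrix.det_fin_two, Finset.prod_ne_zero_iff, Complex.exp_ne_zero]

/-- The sesquilinear form of a matrix. -/
noncomputable def matForm {n : ℕ} (A : Matrix (Fin n) (Fin n) ℂ) : SesqForm (Fin n → ℂ) :=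
  LinearMap.mk₂'ₛₗ _ _ (fun x y => star x ⬝ᵥ (A *ᵥ y))
    (fun x y z => by simp [add_dotProduct]) (fun c x y => by simp [smul_dotProduct])
    (fun x y z => by simp [Matrix.mulVec_add, dotProduct_add])
    (fun c x y => by simp [Matrix.mulVec_smul, dotProduct_smul])

theorem matForm_apply {n : ℕ} (A : Matrix (Fin n) (Fin n) ℂ) (x y : Fin n → ℂ) :
    matForm A x y = star x ⬝ᵥ (A *ᵥ y) := rfl

theorem conj_matForm {n : ℕ} (A : Matrix (Fin n) (Fin n) ℂ) (x y : Fin n → ℂ) :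
    conj (matForm A x y) = matForm Aᴴ y x := by
  rw [matForm_apply, matForm_apply, starRingEnd_apply, star_dotProduct, star_mulVec,
    ← dotProduct_mulVec, star_star]

/-- The hypothesis says that the Hermitian part of `e^{-ia} C` is positive semidefinite, so
`hasStdBasis` applies to it and the skew part; `T` is the inverse of the matrix of basis vectors. -/
theorem exists_hasPhasesAt {n : ℕ} (C : Matrix (Fin n) (Fin n) ℂ) (a : ℝ)
    (hre : ∀ x : Fin n → ℂ, 0 ≤ (Complex.exp (-(a * Complex.I)) * (star x ⬝ᵥ (C *ᵥ x))).re) :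
    ∃ φ : Fin C.rank → ℝ, Antitone φ ∧ HasPhasesAt C a φ := by
  set C' := Complex.exp (-(a * Complex.I)) • C with hC'
  set H := (1 / 2 : ℂ) • (C' + C'ᴴ) with hH
  set K := (-Complex.I / 2 : ℂ) • (C' - C'ᴴ) with hK
  have hHh : Hᴴ = H := by
    simp [hH, Matrix.conjTranspose_smul, add_comm]
  have hKh : Kᴴ = K := by
    simp only [hK, Matrix.conjTranspose_smul, Matrix.conjTranspose_sub,
      Matrix.conjTranspose_conjTranspose, star_div₀, star_neg, Complex.star_def, Complex.conj_I,
      map_ofNat, neg_neg]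
    rw [neg_div, neg_smul, ← smul_neg, neg_sub]
  have hHK : H + Complex.I • K = C' := by
    rw [hH, hK, smul_smul, show Complex.I * (-Complex.I / 2) = 1 / 2 by
      linear_combination (-1 / 2 : ℂ) * Complex.I_mul_I]
    rw [← smul_add, add_add_sub_cancel, ← two_smul ℂ, smul_smul]; norm_num
  have hform : ∀ x y, matForm H x y + Complex.I * matForm K x y = matForm C' x y := fun x y => by
    rw [← hHK]; simp [matForm_apply, Matrix.add_mulVec, Matrix.smul_mulVec]
  have hh : (matForm H).IsHerm := fun x y => by rw [conj_matForm, hHh]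
  have hk : (matForm K).IsHerm := fun x y => by rw [conj_matForm, hKh]
  have hp : ∀ x, 0 ≤ (matForm H x x).re := fun x => by
    have h1 := hform x x
    rw [hk.self_re x] at h1
    have h2 := congrArg Complex.re h1
    simp at h2
    rw [h2, matForm_apply, hC', Matrix.smul_mulVec, dotProduct_smul]
    exact hre x
  obtain ⟨Z, M, P, _, _, _, _, _, θ, b, hθ, hb⟩ := hasStdBasis hh hk hp
  let ez := Fintype.equivFin Z
  let em := Fintype.equivFin M
  let ep := Fintype.equivFin P
  let e0 : (Z ⊕ (M ⊕ (Fin 2 × P))) ≃ _ :=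
    Equiv.sumCongr ez (Equiv.sumCongr em (Equiv.prodCongr (Equiv.refl (Fin 2)) ep))
  let g := b.indexEquiv (Pi.basisFun ℂ (Fin n))
  let Q : Matrix (Fin n) (Fin n) ℂ := (Pi.basisFun ℂ (Fin n)).toMatrix (b.reindex g)
  have hQdet : IsUnit Q.det := by
    have := (Pi.basisFun ℂ (Fin n)).invertibleToMatrix (b.reindex g)
    exact Matrix.isUnit_det_of_invertible Q
  have hQ : ∀ j, Q *ᵥ (Pi.single j 1) = b (g.symm j) := fun j => by
    ext i; simp [Q, Basis.toMatrix_apply]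
  set θ' : Fin (Fintype.card M) → ℝ := fun i => a + θ (em.symm i) with hθ'
  set e := e0.symm.trans g with he
  set Mid := Matrix.reindex e e (gsdMiddle _ _ (Fintype.card P) a θ') with hMid
  have hmid : ∀ i j, gsdMiddle (Fintype.card Z) _ (Fintype.card P) a θ' (e0 i) (e0 j)
      = Complex.exp (a * Complex.I) * stdForm Z M P θ i j := by
    intro i j
    rcases i with i | i | i <;> rcases j with j | j | j <;>
      simp [gsdMiddle, stdForm, e0, Matrix.diagonal_apply, Matrix.blockDiagonal_apply, hθ',
        add_mul, Complex.exp_add]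
    obtain ⟨i1, i2⟩ := i
    obtain ⟨j1, j2⟩ := j
    fin_cases i1 <;> fin_cases j1 <;> simp
  have hQC : Qᴴ * C * Q = Mid := by
    ext i j
    have h1 : (Qᴴ * C * Q) i j = matForm C (b (g.symm i)) (b (g.symm j)) := by
      rw [matForm_apply, ← hQ, ← hQ, star_mulVec, ← dotProduct_mulVec, mulVec_mulVec,
        mulVec_mulVec]
      simp
    have h2 := hform (b (g.symm i)) (b (g.symm j))
    rw [hb] at h2
    have h3 : matForm C (b (g.symm i)) (b (g.symm j))
        = Complex.exp (a * Complex.I) * stdForm Z M P θ (g.symm i) (g.symm j) := by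
      rw [h2, hC', matForm_apply, matForm_apply, Matrix.smul_mulVec, dotProduct_smul,
        smul_eq_mul, ← mul_assoc, ← Complex.exp_add]
      simp
    rw [h1, h3, ← hmid]
    simp [hMid, he]
  have hQQ : Q * Q⁻¹ = 1 := Matrix.mul_nonsing_inv Q hQdet
  have hCeq : C = Q⁻¹ᴴ * Mid * Q⁻¹ := by
    rw [← hQC]
    have : Q⁻¹ᴴ * Qᴴ = 1 := by rw [← Matrix.conjTranspose_mul, hQQ, Matrix.conjTranspose_one]
    calc C = (Q⁻¹ᴴ * Qᴴ) * C * (Q * Q⁻¹) := by rw [this, hQQ]; simp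
      _ = _ := by simp only [Matrix.mul_assoc]
  have hTdet : IsUnit (Q⁻¹).det := by
    rw [Matrix.det_nonsing_inv]; exact hQdet.ringInverse
  have hTdet' : IsUnit (Q⁻¹ᴴ).det := by
    rw [Matrix.det_conjTranspose]; exact hTdet.star
  have hrank : C.rank = Fintype.card M + (Fintype.card P + Fintype.card P) := by
    conv_lhs => rw [hCeq]
    rw [Matrix.rank_mul_eq_left_of_isUnit_det _ _ hTdet,
      Matrix.rank_mul_eq_right_of_isUnit_det _ _ hTdet', hMid, Matrix.rank_reindex,
      rank_gsdMiddle]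
  let σ : Fin C.rank ≃ (Fin (Fintype.card M) ⊕ (Fin (Fintype.card P) ⊕ Fin (Fintype.card P))) :=
    Fintype.equivOfCardEq (by simp [hrank])
  set φ : Fin C.rank → ℝ := fun j => Sum.elim θ'
      (Sum.elim (fun _ => a + Real.pi / 2) (fun _ => a - Real.pi / 2)) (σ j) with hφ
  have hφa : HasPhasesAt C a φ := by
    refine ⟨_, _, _, e, θ', Q⁻¹, σ, fun i => ?_, hTdet, hCeq, fun j => rfl⟩
    have := abs_le.1 (hθ (em.symm i))
    constructor <;> simp only [hθ'] <;> linarith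
  refine ⟨φ ∘ Tuple.sort (fun j => - φ j), ?_, hφa.comp_equiv _⟩
  intro i j hij
  have := Tuple.monotone_sort (fun j => - φ j) hij
  simpa using this

/-! ### Convexity of the numerical range and a supporting half-plane. -/

/-- For every direction `d` some unimodular `w` makes the cross term `w p + w̄ q` a nonnegative
multiple of `d`. -/
theorem exists_unit_cross (p q d : ℂ) (hd : d ≠ 0) :
    ∃ w : ℂ, conj w * w = 1 ∧ ∃ t : ℝ, 0 ≤ t ∧ w * p + conj w * q = t * d := by
  obtain ⟨w, hw, hL⟩ : ∃ w : ℂ, conj w * w = 1 ∧ ((w * p + conj w * q) / d).im = 0 := by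
    -- For `w = r + is` the imaginary part to be killed is the real linear form `rα + sβ`, so `(r,
    -- s)` is taken proportional to `(β, -α)`.
    set α := ((p + q) / d).im with hα
    set β := ((Complex.I * (p - q)) / d).im with hβ
    have hD : ∀ r s : ℝ, (((r + s * Complex.I) * p + conj ((r + s * Complex.I) : ℂ) * q) / d).im
        = r * α + s * β := by
      intro r s
      have : ((r + s * Complex.I) * p + conj ((r + s * Complex.I) : ℂ) * q) / d
          = r * ((p + q) / d) + s * ((Complex.I * (p - q)) / d) := by
        simp only [map_add, map_mul, Complex.conj_ofReal, Complex.conj_I]; ring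
      rw [this, hα, hβ]; simp
    by_cases h0 : α = 0 ∧ β = 0
    · refine ⟨1, by simp, ?_⟩
      have := hD 1 0
      simpa [h0.1] using this
    · have hn : 0 < β ^ 2 + α ^ 2 := by
        by_contra hcon
        have h1 : β ^ 2 + α ^ 2 ≤ 0 := not_lt.1 hcon
        have h2 := sq_nonneg α
        have h3 := sq_nonneg β
        exact h0 ⟨by simpa using (show α ^ 2 = 0 by linarith),
          by simpa using (show β ^ 2 = 0 by linarith)⟩
      set N := Real.sqrt (β ^ 2 + α ^ 2) with hN
      have hN0 : N ≠ 0 := (Real.sqrt_pos.2 hn).ne'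
      have hN2 : N ^ 2 = β ^ 2 + α ^ 2 := Real.sq_sqrt hn.le
      refine ⟨(β / N : ℝ) + (-α / N : ℝ) * Complex.I, ?_, ?_⟩
      · have : (β / N) ^ 2 + (-α / N) ^ 2 = 1 := by
          field_simp; rw [hN2]
        have h2 : ((β / N : ℝ) : ℂ) ^ 2 + ((-α / N : ℝ) : ℂ) ^ 2 = 1 := by exact_mod_cast this
        simp only [map_add, map_mul, Complex.conj_ofReal, Complex.conj_I]
        linear_combination h2 - ((-α / N : ℝ) : ℂ) ^ 2 * Complex.I_mul_I
      · rw [hD]; field_simp; ring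
  set t := ((w * p + conj w * q) / d).re with ht
  have h1 : (w * p + conj w * q) / d = t := Complex.ext (by simp [ht]) (by simp [hL])
  have h2 : w * p + conj w * q = t * d := by rw [← h1]; field_simp
  -- Passing to `-w` reverses the sign of the cross term.
  rcases le_total 0 t with h | h
  · exact ⟨w, hw, t, h, h2⟩
  · refine ⟨-w, by simpa using hw, -t, by linarith, ?_⟩
    simp only [map_neg]; push_cast
    linear_combination -h2

theorem matForm_add_smul {n : ℕ} (C : Matrix (Fin n) (Fin n) ℂ) (x y : Fin n → ℂ) (w : ℂ) :
    matForm C (x + w • y) (x + w • y) = matForm C x x + conj w * w * matForm C y y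
      + (w * matForm C x y + conj w * matForm C y x) := by
  simp only [map_add, LinearMap.add_apply, LinearMap.map_smulₛₗ, map_smul,
    LinearMap.smul_apply, smul_eq_mul]
  ring

theorem matForm_smul_self {n : ℕ} (C : Matrix (Fin n) (Fin n) ℂ) (x : Fin n → ℂ) (w : ℂ) :
    matForm C (w • x) (w • x) = conj w * w * matForm C x x := by
  simp only [LinearMap.map_smulₛₗ, map_smul, LinearMap.smul_apply, smul_eq_mul]
  ring

theorem exists_matForm_smul {n : ℕ} (C : Matrix (Fin n) (Fin n) ℂ) (x : Fin n → ℂ) {t : ℝ}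
    (ht : 0 ≤ t) : ∃ y, matForm C y y = t * matForm C x x := by
  refine ⟨(Real.sqrt t : ℂ) • x, ?_⟩
  rw [matForm_smul_self, Complex.conj_ofReal, ← Complex.ofReal_mul, Real.mul_self_sqrt ht]

/-- The Toeplitz–Hausdorff theorem, in conic form. -/
theorem exists_matForm_add {n : ℕ} (C : Matrix (Fin n) (Fin n) ℂ) (x y : Fin n → ℂ) :
    ∃ z, matForm C z z = matForm C x x + matForm C y y := by
  by_cases h0 : matForm C x x + matForm C y y = 0
  · exact ⟨0, by simp [h0]⟩
  -- A cross term along the sum itself makes the value at `x + w y` equal to `1 + t` times the sum,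
  -- and rescaling the vector removes this factor.
  obtain ⟨w, hw, t, ht, hc⟩ := exists_unit_cross (matForm C x y) (matForm C y x) _ h0
  have h1 : matForm C (x + w • y) (x + w • y)
      = ((1 + t : ℝ) : ℂ) * (matForm C x x + matForm C y y) := by
    rw [matForm_add_smul, hw, hc]; push_cast; ring
  obtain ⟨z, hz⟩ := exists_matForm_smul C (x + w • y) (t := (1 + t)⁻¹) (by positivity)
  refine ⟨z, ?_⟩
  have h2 : ((1 + t : ℝ) : ℂ) ≠ 0 := by exact_mod_cast (by positivity : (1 + t : ℝ) ≠ 0)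
  rw [hz, h1, ← mul_assoc, Complex.ofReal_inv, inv_mul_cancel₀ h2, one_mul]

theorem convex_range_matForm {n : ℕ} (C : Matrix (Fin n) (Fin n) ℂ) :
    Convex ℝ (Set.range fun x => matForm C x x) := by
  rintro _ ⟨x, rfl⟩ _ ⟨y, rfl⟩ a b ha hb _
  obtain ⟨x', hx⟩ := exists_matForm_smul C x ha
  obtain ⟨y', hy⟩ := exists_matForm_smul C y hb
  obtain ⟨z, hz⟩ := exists_matForm_add C x' y'
  exact ⟨z, by simp [hz, hx, hy]⟩

/-- With a real cross term `t`, the value at `x + s w y` is `1 + ts - s²`, and `s` is a root. The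
vector is nonzero, since the values at proportional vectors cannot have opposite signs. -/
theorem exists_isotropic {n : ℕ} (C : Matrix (Fin n) (Fin n) ℂ) {x y : Fin n → ℂ}
    (hx : matForm C x x = 1) (hy : matForm C y y = -1) : ∃ z, z ≠ 0 ∧ matForm C z z = 0 := by
  obtain ⟨w, hw, t, ht, hc⟩ := exists_unit_cross (matForm C x y) (matForm C y x) 1 one_ne_zero
  set s := (t + Real.sqrt (t ^ 2 + 4)) / 2 with hs
  have hs2 : s ^ 2 - t * s - 1 = 0 := by
    have := Real.sq_sqrt (show 0 ≤ t ^ 2 + 4 by positivity)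
    rw [hs]; linear_combination this / 4
  have hs2' : (s : ℂ) ^ 2 - t * s - 1 = 0 := by exact_mod_cast hs2
  refine ⟨x + ((s : ℂ) * w) • y, fun h0 => ?_, ?_⟩
  · have h1 : x = (-((s : ℂ) * w)) • y := by rw [neg_smul]; exact eq_neg_of_add_eq_zero_left h0
    rw [h1, matForm_smul_self, hy] at hx
    have h2 : (-s ^ 2 : ℂ) = 1 := by
      simp only [map_neg, map_mul, Complex.conj_ofReal] at hx
      linear_combination hx + (s : ℂ) ^ 2 * hw
    have h3 : -s ^ 2 = 1 := by exact_mod_cast h2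
    nlinarith [sq_nonneg s]
  · rw [matForm_add_smul, hx, hy]
    simp only [map_mul, Complex.conj_ofReal]
    linear_combination (s : ℂ) * hc - (s : ℂ) ^ 2 * hw - hs2'

/-- If `S` has interior, Hahn–Banach separates it from an outside point, and a functional bounded
above on a cone is nonpositive there. If not, `S` spans a proper real subspace, on which some
nonzero functional vanishes. -/
theorem exists_halfplane_of_cone (S : Set ℂ) (hS : Convex ℝ S) (h0 : (0 : ℂ) ∈ S)
    (hsmul : ∀ w ∈ S, ∀ t : ℝ, 0 ≤ t → (t : ℂ) * w ∈ S) (hne : S ≠ Set.univ) :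
    ∃ a : ℝ, ∀ w ∈ S, 0 ≤ (Complex.exp (-(a * Complex.I)) * w).re := by
  obtain ⟨f, hf0, hf⟩ : ∃ f : ℂ →ₗ[ℝ] ℝ, f ≠ 0 ∧ ∀ w ∈ S, f w ≤ 0 := by
    by_cases hint : (interior S).Nonempty
    · obtain ⟨w₀, hw₀⟩ := (Set.ne_univ_iff_exists_notMem S).1 hne
      obtain ⟨f, hf0, hf⟩ := geometric_hahn_banach_of_nonempty_interior_point hS
        (fun h => hw₀ (interior_subset h)) hint
      refine ⟨f, fun h => hf0 (ContinuousLinearMap.coe_injective h), fun w hw => ?_⟩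
      by_contra! hcon
      have hcon' : 0 < f w := hcon
      have hb : 0 ≤ f w₀ := by simpa using hf 0 h0
      have h1 := hf _ (hsmul w hw ((f w₀ + 1) / f w) (by positivity))
      rw [← Complex.real_smul, map_smul, smul_eq_mul, div_mul_cancel₀ _ hcon'.ne'] at h1
      linarith
    · have hspan : Submodule.span ℝ S ≠ ⊤ := by
        intro htop
        apply hint
        rw [hS.interior_nonempty_iff_affineSpan_eq_top]
        have := affineSpan_insert_zero (k := ℝ) (s := S)
        rw [Set.insert_eq_of_mem h0, htop] at this
        exact SetLike.coe_injective (by simpa using this)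
      obtain ⟨f, hf0, hf⟩ := Submodule.exists_dual_map_eq_bot_of_lt_top (lt_top_iff_ne_top.2 hspan)
        inferInstance
      refine ⟨f, hf0, fun w hw => le_of_eq ?_⟩
      have : f w ∈ (Submodule.span ℝ S).map f := ⟨w, Submodule.subset_span hw, rfl⟩
      rw [hf] at this
      simpa using this
  -- Chosen so that `f w = -Re (d w)`; the half-plane is centred at `-arg d`.
  set d : ℂ := ⟨-f 1, f Complex.I⟩ with hd
  have hfw : ∀ w : ℂ, (d * w).re = - f w := fun w => by
    conv_rhs => rw [show w = w.re • (1 : ℂ) + w.im • Complex.I by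
      apply Complex.ext <;> simp]
    rw [map_add, map_smul, map_smul]; simp [hd]; ring
  have hdne : d ≠ 0 := fun h => hf0 (LinearMap.ext fun w => by
    have := hfw w; rw [h] at this; simpa using this)
  refine ⟨-d.arg, fun w hw => ?_⟩
  have h1 := hfw w
  rw [← Complex.norm_mul_exp_arg_mul_I d, mul_assoc, Complex.re_ofReal_mul] at h1
  have h2 : 0 < ‖d‖ := norm_pos_iff.2 hdne
  have h3 := hf w hw
  push_cast
  rw [neg_mul, neg_neg]
  by_contra! hcon
  nlinarith

theorem isSemiSectorial_of_halfplane {n : ℕ} {C : Matrix (Fin n) (Fin n) ℂ}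
    (hne : angularNumericalRange C ≠ Set.univ) (a : ℝ)
    (ha : ∀ x, 0 ≤ (Complex.exp (-(a * Complex.I)) * matForm C x x).re) :
    IsSemiSectorial C := by
  rw [IsSemiSectorial, fieldAngle, if_neg hne]
  split_ifs with h
  · exact le_rfl
  refine csInf_le ⟨0, fun d hd => hd.1⟩ ⟨Real.pi_pos.le, a - Real.pi / 2, ?_⟩
  rintro _ ⟨x, -, rfl⟩
  set w := Complex.exp (-(a * Complex.I)) * matForm C x x with hw
  have harg := abs_le.1 (Complex.abs_arg_le_pi_div_two_iff.2 (ha x))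
  refine ⟨‖w‖, a + w.arg, norm_nonneg _, by linarith, by linarith, ?_⟩
  have h1 := Complex.norm_mul_exp_arg_mul_I w
  push_cast
  rw [add_mul, Complex.exp_add, mul_left_comm, h1, hw, ← mul_assoc, ← Complex.exp_add]
  simp [matForm_apply]

theorem IsSemiSectorial.ne_univ {n : ℕ} {C : Matrix (Fin n) (Fin n) ℂ} (h : IsSemiSectorial C) :
    angularNumericalRange C ≠ Set.univ := by
  intro hu
  rw [IsSemiSectorial, fieldAngle, if_pos hu] at h
  linarith [Real.pi_pos]

/-- The cone argument includes `x = 0`, which `angularNumericalRange` excludes. If the form were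
onto `ℂ`, a nonzero isotropic vector would supply the value `0` and the two sets would agree. -/
theorem exists_halfplane_of_ne_univ {n : ℕ} {C : Matrix (Fin n) (Fin n) ℂ}
    (h : angularNumericalRange C ≠ Set.univ) :
    ∃ a : ℝ, ∀ x, 0 ≤ (Complex.exp (-(a * Complex.I)) * matForm C x x).re := by
  have hne : (Set.range fun x => matForm C x x) ≠ Set.univ := by
    intro hu
    obtain ⟨x, hx⟩ : (1 : ℂ) ∈ Set.range fun x => matForm C x x := hu ▸ Set.mem_univ _
    obtain ⟨y, hy⟩ : (-1 : ℂ) ∈ Set.range fun x => matForm C x x := hu ▸ Set.mem_univ _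
    obtain ⟨z, hz0, hz⟩ := exists_isotropic C hx hy
    refine h (Set.eq_univ_of_forall fun w => ?_)
    obtain ⟨v, hv⟩ : w ∈ Set.range fun x => matForm C x x := hu ▸ Set.mem_univ _
    by_cases hv0 : v = 0
    · refine ⟨z, hz0, ?_⟩
      rw [← hv, hv0, ← matForm_apply, hz]; simp
    · exact ⟨v, hv0, hv.symm⟩
  obtain ⟨a, ha⟩ := exists_halfplane_of_cone _ (convex_range_matForm C) ⟨0, by simp⟩
    (by rintro _ ⟨x, rfl⟩ t ht
        obtain ⟨y, hy⟩ := exists_matForm_smul C x ht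
        exact ⟨y, hy⟩) hne
  exact ⟨a, fun x => ha _ ⟨x, rfl⟩⟩

/-! ### Counting phases on one side of an angle by inertia. -/

/-- The quadratic form of the middle factor of a generalized sectorial decomposition. -/
noncomputable def stdQuad {z m p : ℕ} (a : ℝ) (θ : Fin m → ℝ)
    (y : Fin z ⊕ (Fin m ⊕ (Fin 2 × Fin p)) → ℂ) : ℂ :=
  ∑ k, Complex.exp (θ k * Complex.I) * (Complex.normSq (y (.inr (.inl k))) : ℂ) +
  ∑ q, Complex.exp (a * Complex.I) *
    ((Complex.normSq (y (.inr (.inr (0, q)))) : ℂ) + Complex.normSq (y (.inr (.inr (1, q))))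
      + 2 * (conj (y (.inr (.inr (0, q)))) * y (.inr (.inr (1, q)))))

theorem dotProduct_gsdMiddle_mulVec {z m p : ℕ} (a : ℝ) (θ : Fin m → ℝ)
    (y : Fin z ⊕ (Fin m ⊕ (Fin 2 × Fin p)) → ℂ) :
    star y ⬝ᵥ (gsdMiddle z m p a θ *ᵥ y) = stdQuad a θ y := by
  simp only [dotProduct, mulVec, Fintype.sum_sum_type, gsdMiddle, stdQuad, Matrix.fromBlocks_apply₁₁,
    Matrix.fromBlocks_apply₁₂, Matrix.fromBlocks_apply₂₁, Matrix.fromBlocks_apply₂₂,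
    Matrix.zero_apply, zero_mul, Finset.sum_const_zero, add_zero, zero_add, mul_zero,
    Matrix.diagonal_apply, ite_mul, Finset.sum_ite_eq, Finset.mem_univ, if_true]
  congr 1
  · refine Finset.sum_congr rfl fun k _ => ?_
    rw [Complex.normSq_eq_conj_mul_self]
    simp only [Pi.star_apply, Complex.star_def]; ring
  · rw [Fintype.sum_prod_type, Fin.sum_univ_two, ← Finset.sum_add_distrib]
    refine Finset.sum_congr rfl fun q _ => ?_
    simp only [Fintype.sum_prod_type, Fin.sum_univ_two, Matrix.blockDiagonal_apply, ite_mul,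
      zero_mul, Finset.sum_ite_eq, Finset.mem_univ, if_true, Complex.normSq_eq_conj_mul_self]
    simp
    ring

theorem matForm_eq_stdQuad {n z m p : ℕ} {C T : Matrix (Fin n) (Fin n) ℂ} {a : ℝ}
    {θ : Fin m → ℝ} {e : (Fin z ⊕ (Fin m ⊕ (Fin 2 × Fin p))) ≃ Fin n}
    (hC : C = Tᴴ * Matrix.reindex e e (gsdMiddle z m p a θ) * T) (x : Fin n → ℂ) :
    matForm C x x = stdQuad a θ ((T *ᵥ x) ∘ e) := by
  rw [← dotProduct_gsdMiddle_mulVec, matForm_apply]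
  conv_lhs => rw [hC]
  rw [← mulVec_mulVec, ← mulVec_mulVec, dotProduct_mulVec, ← star_mulVec, Matrix.reindex_apply,
    Matrix.submatrix_mulVec_equiv, Equiv.symm_symm]
  rw [dotProduct_comp_equiv_symm]
  rfl

theorem HasPhasesAt.exists_coords {n : ℕ} {C : Matrix (Fin n) (Fin n) ℂ} {a : ℝ} {J : Type}
    {φ : J → ℝ} (h : HasPhasesAt C a φ) :
    ∃ (z m p : ℕ) (θ : Fin m → ℝ)
      (Y : (Fin n → ℂ) ≃ₗ[ℂ] (Fin z ⊕ (Fin m ⊕ (Fin 2 × Fin p)) → ℂ))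
      (σ : J ≃ (Fin m ⊕ (Fin p ⊕ Fin p))),
      (∀ k, a - Real.pi / 2 ≤ θ k ∧ θ k ≤ a + Real.pi / 2) ∧
      (∀ x, matForm C x x = stdQuad a θ (Y x)) ∧
      ∀ j, φ j = Sum.elim θ
        (Sum.elim (fun _ => a + Real.pi / 2) (fun _ => a - Real.pi / 2)) (σ j) := by
  obtain ⟨z, m, p, e, θ, T, σ, h1, h2, h3, h4⟩ := h
  have := Matrix.invertibleOfIsUnitDet T h2
  refine ⟨z, m, p, θ, (Matrix.toLinearEquiv' T this).trans (LinearEquiv.funCongrLeft ℂ ℂ e), σ,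
    h1, fun x => matForm_eq_stdQuad h3 x, h4⟩

/-- The rotated imaginary part is a Hermitian form in which a phase `θ` of `D` has coefficient `sin
(θ - α)`, so its sign records the side of `α` on which `θ` lies. -/
theorem im_rotate_stdQuad {z m p : ℕ} (a α : ℝ) (θ : Fin m → ℝ)
    (y : Fin z ⊕ (Fin m ⊕ (Fin 2 × Fin p)) → ℂ) :
    (Complex.exp (-(α * Complex.I)) * stdQuad a θ y).im =
      ∑ k, Real.sin (θ k - α) * Complex.normSq (y (.inr (.inl k))) +
      ∑ q, (Real.sin (a - α) * (Complex.normSq (y (.inr (.inr (0, q))))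
          + Complex.normSq (y (.inr (.inr (1, q)))))
        + 2 * (Complex.exp ((a - α : ℝ) * Complex.I) *
          (conj (y (.inr (.inr (0, q)))) * y (.inr (.inr (1, q))))).im) := by
  have hexp : ∀ t : ℝ, Complex.exp (-(α * Complex.I)) * Complex.exp (t * Complex.I)
      = Complex.exp ((t - α : ℝ) * Complex.I) := fun t => by
    rw [← Complex.exp_add]; congr 1; push_cast; ring
  rw [stdQuad, mul_add, Finset.mul_sum, Finset.mul_sum, Complex.add_im, Complex.im_sum,
    Complex.im_sum]
  congr 1
  · refine Finset.sum_congr rfl fun k _ => ?_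
    rw [← mul_assoc, hexp, Complex.im_mul_ofReal, Complex.exp_ofReal_mul_I_im]
  · refine Finset.sum_congr rfl fun q _ => ?_
    rw [← mul_assoc, hexp, mul_add, Complex.add_im, ← Complex.ofReal_add, Complex.im_mul_ofReal,
      Complex.exp_ofReal_mul_I_im]
    congr 1
    rw [mul_left_comm, show (2 : ℂ) = ((2 : ℝ) : ℂ) by norm_num, Complex.im_ofReal_mul]

/-- Since `a - π/2 < α < a + π/2`, each block of `E` contributes exactly one phase to either side.
The sign `s` selects the side: above for `1`, below for `-1`. -/
theorem card_filter_phases {J : Type} [Fintype J] {m p : ℕ} {a α s : ℝ} (hα : |α - a| < Real.pi / 2)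
    (hs : s = 1 ∨ s = -1) {φ : J → ℝ} {θ : Fin m → ℝ} (σ : J ≃ (Fin m ⊕ (Fin p ⊕ Fin p)))
    (h : ∀ j, φ j = Sum.elim θ
        (Sum.elim (fun _ => a + Real.pi / 2) (fun _ => a - Real.pi / 2)) (σ j)) :
    Fintype.card ({k // 0 < s * (θ k - α)} ⊕ Fin p) =
      (Finset.univ.filter fun j => 0 < s * (φ j - α)).card := by
  have := abs_lt.1 hα
  let F : Fin m ⊕ (Fin p ⊕ Fin p) → ℕ := fun i =>
    if 0 < s * (Sum.elim θ (Sum.elim (fun _ => a + Real.pi / 2) (fun _ => a - Real.pi / 2)) i - α)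
    then 1 else 0
  have h2 : (Finset.univ.filter fun j => 0 < s * (φ j - α)).card = ∑ i, F i := by
    rw [Finset.card_filter, ← Equiv.sum_comp σ]
    exact Finset.sum_congr rfl fun j _ => by rw [h]
  have h3 : Fintype.card {k // 0 < s * (θ k - α)} = ∑ k, F (.inl k) := by
    rw [Fintype.card_subtype, Finset.card_filter]
    rfl
  rw [h2, Fintype.card_sum, h3, Fintype.sum_sum_type, Fintype.sum_sum_type]
  congr 1
  rcases hs with rfl | rfl
  · have e1 : ∀ i, F (.inr (.inl i)) = 1 := fun i =>
      if_pos (show 0 < 1 * (a + Real.pi / 2 - α) by linarith)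
    have e2 : ∀ i, F (.inr (.inr i)) = 0 := fun i =>
      if_neg (show ¬ 0 < 1 * (a - Real.pi / 2 - α) by linarith)
    simp [e1, e2]
  · have e1 : ∀ i, F (.inr (.inl i)) = 0 := fun i =>
      if_neg (show ¬ 0 < -1 * (a + Real.pi / 2 - α) by linarith)
    have e2 : ∀ i, F (.inr (.inr i)) = 1 := fun i =>
      if_pos (show 0 < -1 * (a - Real.pi / 2 - α) by linarith)
    simp [e1, e2]

theorem abs_sin_lt_one {a α : ℝ} (hα : |α - a| < Real.pi / 2) : |Real.sin (a - α)| < 1 := by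
  have h1 := abs_lt.1 hα
  have hc : 0 < Real.cos (a - α) := Real.cos_pos_of_mem_Ioo ⟨by linarith, by linarith⟩
  rw [← sq_lt_one_iff_abs_lt_one]
  nlinarith [Real.sin_sq_add_cos_sq (a - α)]

theorem mul_sin_pos {s t : ℝ} (hs : s = 1 ∨ s = -1) (ht : |t| < Real.pi) (h : 0 < s * t) :
    0 < s * Real.sin t := by
  have := abs_lt.1 ht
  rcases hs with rfl | rfl
  · have := Real.sin_pos_of_pos_of_lt_pi (x := t) (by linarith) (by linarith)
    linarith
  · have := Real.sin_pos_of_pos_of_lt_pi (x := -t) (by linarith) (by linarith)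
    rw [Real.sin_neg] at this
    linarith

theorem mul_sin_nonpos {s t : ℝ} (hs : s = 1 ∨ s = -1) (ht : |t| < Real.pi) (h : ¬ 0 < s * t) :
    s * Real.sin t ≤ 0 := by
  have := abs_lt.1 ht
  rcases hs with rfl | rfl
  · have := Real.sin_nonneg_of_nonneg_of_le_pi (x := -t) (by linarith) (by linarith)
    rw [Real.sin_neg] at this
    linarith
  · have := Real.sin_nonneg_of_nonneg_of_le_pi (x := t) (by linarith) (by linarith)
    linarith

/-- The contribution of one `2 × 2` block on a line `v = ε i e^{-iβ} u`. -/
theorem block_value (β ε : ℝ) (hε : ε ^ 2 = 1) (u : ℂ) :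
    Real.sin β * (Complex.normSq u +
        Complex.normSq (ε * Complex.I * Complex.exp (-(β * Complex.I)) * u))
      + 2 * (Complex.exp (β * Complex.I) *
          (conj u * (ε * Complex.I * Complex.exp (-(β * Complex.I)) * u))).im
      = 2 * (Real.sin β + ε) * Complex.normSq u := by
  have h1 : Complex.normSq (ε * Complex.I * Complex.exp (-(β * Complex.I)) * u)
      = Complex.normSq u := by
    rw [map_mul, map_mul, map_mul, Complex.normSq_ofReal, Complex.normSq_I,
      Complex.normSq_eq_norm_sq (Complex.exp _), ← neg_mul, ← Complex.ofReal_neg,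
      Complex.norm_exp_ofReal_mul_I]
    rw [← sq, hε]; ring
  have h2 : Complex.exp (β * Complex.I) *
      (conj u * (ε * Complex.I * Complex.exp (-(β * Complex.I)) * u))
      = ((ε * Complex.normSq u : ℝ) : ℂ) * Complex.I := by
    have : Complex.exp (β * Complex.I) * Complex.exp (-(β * Complex.I)) = 1 := by
      rw [← Complex.exp_add]; simp
    rw [Complex.ofReal_mul, Complex.normSq_eq_conj_mul_self]
    linear_combination (conj u * ε * Complex.I * u) * this
  rw [h1, h2, Complex.im_ofReal_mul, Complex.I_im]; ring

/-- The definite subspace is spanned by the coordinates of `D` with phase on side `s` and one line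
from each block. On the line with `ε = s`, `block_value` has the sign of `s` because `|sin (a - α)|
< 1`. -/
theorem HasPhasesAt.exists_positive {n : ℕ} {C : Matrix (Fin n) (Fin n) ℂ} {a α s : ℝ} {J : Type}
    [Fintype J] {φ : J → ℝ} (h : HasPhasesAt C a φ) (hα : |α - a| < Real.pi / 2)
    (hs : s = 1 ∨ s = -1) :
    ∃ (K : Type) (_ : Fintype K) (L : (K → ℂ) →ₗ[ℂ] (Fin n → ℂ)),
      Fintype.card K = (Finset.univ.filter fun j => 0 < s * (φ j - α)).card ∧
      ∀ c ≠ 0, 0 < s * (Complex.exp (-(α * Complex.I)) * matForm C (L c) (L c)).im := by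
  classical
  obtain ⟨z, m, p, θ, Y, σ, h1, h2, h3⟩ := h.exists_coords
  have hα' := abs_lt.1 hα
  let κ : ℂ := s * Complex.I * Complex.exp (-((a - α : ℝ) * Complex.I))
  let L0 : ({k // 0 < s * (θ k - α)} ⊕ Fin p → ℂ) →ₗ[ℂ]
      (Fin z ⊕ (Fin m ⊕ (Fin 2 × Fin p)) → ℂ) := LinearMap.pi
    (Sum.elim (fun _ => 0) (Sum.elim
      (fun k => if hk : 0 < s * (θ k - α) then LinearMap.proj (Sum.inl ⟨k, hk⟩) else 0)
      (fun q => (![1, κ] q.1) • LinearMap.proj (Sum.inr q.2))))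
  refine ⟨_, inferInstance, Y.symm.toLinearMap ∘ₗ L0, card_filter_phases hα hs σ h3,
    fun c hc => ?_⟩
  rw [h2]
  simp only [LinearMap.comp_apply, LinearEquiv.coe_coe, LinearEquiv.apply_symm_apply]
  rw [im_rotate_stdQuad]
  have hs2 : s ^ 2 = 1 := by rcases hs with rfl | rfl <;> norm_num
  have eD : ∀ k, L0 c (.inr (.inl k)) = if hk : 0 < s * (θ k - α) then c (.inl ⟨k, hk⟩) else 0 := by
    intro k
    by_cases hk : 0 < s * (θ k - α) <;> simp [L0, hk]
  have e0 : ∀ q, L0 c (.inr (.inr (0, q))) = c (.inr q) := fun q => by simp [L0]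
  have e1 : ∀ q, L0 c (.inr (.inr (1, q)))
      = s * Complex.I * Complex.exp (-((a - α : ℝ) * Complex.I)) * c (.inr q) := fun q => by
    simp [L0, κ]
  simp only [e0, e1, block_value _ s hs2, eD]
  rw [mul_add, Finset.mul_sum, Finset.mul_sum]
  have hsin := abs_lt.1 (abs_sin_lt_one hα)
  have hpos2 : 0 < s * (2 * (Real.sin (a - α) + s)) := by
    rcases hs with rfl | rfl <;> linarith
  have n1 : ∀ k, 0 ≤ s * (Real.sin (θ k - α) * Complex.normSq
      (if hk : 0 < s * (θ k - α) then c (.inl ⟨k, hk⟩) else 0)) := by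
    intro k
    by_cases hk : 0 < s * (θ k - α)
    · rw [← mul_assoc]
      exact mul_nonneg (mul_sin_pos hs (abs_lt.2 ⟨by linarith [(h1 k).1], by linarith [(h1 k).2]⟩)
        hk).le (Complex.normSq_nonneg _)
    · simp [hk]
  have n2 : ∀ q, 0 ≤ s * (2 * (Real.sin (a - α) + s) * Complex.normSq (c (.inr q))) := fun q => by
    rw [← mul_assoc]
    exact mul_nonneg hpos2.le (Complex.normSq_nonneg _)
  obtain ⟨i, hi⟩ := Function.ne_iff.1 hc
  rcases i with ⟨k, hk⟩ | q
  · refine add_pos_of_pos_of_nonneg (Finset.sum_pos' (fun k _ => n1 k) ⟨k, Finset.mem_univ _, ?_⟩)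
      (Finset.sum_nonneg fun q _ => n2 q)
    rw [dif_pos hk, ← mul_assoc]
    exact mul_pos (mul_sin_pos hs (abs_lt.2 ⟨by linarith [(h1 k).1], by linarith [(h1 k).2]⟩)
        hk) (Complex.normSq_pos.2 hi)
  · refine add_pos_of_nonneg_of_pos (Finset.sum_nonneg fun k _ => n1 k)
      (Finset.sum_pos' (fun q _ => n2 q) ⟨q, Finset.mem_univ _, ?_⟩)
    rw [← mul_assoc]
    exact mul_pos hpos2 (Complex.normSq_pos.2 hi)

/-- The complementary bound: as many linear conditions as there are phases on side `s` suffice for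
semidefiniteness of the opposite sign. They kill those coordinates of `D` and confine each block to
the line with `ε = -s`. -/
theorem HasPhasesAt.exists_nonpositive {n : ℕ} {C : Matrix (Fin n) (Fin n) ℂ} {a α s : ℝ}
    {J : Type} [Fintype J] {φ : J → ℝ} (h : HasPhasesAt C a φ) (hα : |α - a| < Real.pi / 2)
    (hs : s = 1 ∨ s = -1) :
    ∃ (K : Type) (_ : Fintype K) (G : (Fin n → ℂ) →ₗ[ℂ] (K → ℂ)),
      Fintype.card K = (Finset.univ.filter fun j => 0 < s * (φ j - α)).card ∧
      ∀ x, G x = 0 → s * (Complex.exp (-(α * Complex.I)) * matForm C x x).im ≤ 0 := by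
  classical
  obtain ⟨z, m, p, θ, Y, σ, h1, h2, h3⟩ := h.exists_coords
  have hα' := abs_lt.1 hα
  let κ : ℂ := ((-s : ℝ) : ℂ) * Complex.I * Complex.exp (-((a - α : ℝ) * Complex.I))
  let G0 : (Fin z ⊕ (Fin m ⊕ (Fin 2 × Fin p)) → ℂ) →ₗ[ℂ]
      ({k // 0 < s * (θ k - α)} ⊕ Fin p → ℂ) := LinearMap.pi
    (Sum.elim (fun k => LinearMap.proj (.inr (.inl k.1)))
      (fun q => LinearMap.proj (.inr (.inr (1, q))) - κ • LinearMap.proj (.inr (.inr (0, q)))))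
  refine ⟨_, inferInstance, G0 ∘ₗ Y.toLinearMap, card_filter_phases hα hs σ h3, fun x hx => ?_⟩
  rw [h2, im_rotate_stdQuad]
  set y := Y x with hy
  have hs2 : (-s) ^ 2 = 1 := by rcases hs with rfl | rfl <;> norm_num
  have eD : ∀ k, 0 < s * (θ k - α) → y (.inr (.inl k)) = 0 := fun k hk =>
    congrFun hx (.inl ⟨k, hk⟩)
  have e1 : ∀ q, y (.inr (.inr (1, q))) = ((-s : ℝ) : ℂ) * Complex.I *
      Complex.exp (-((a - α : ℝ) * Complex.I)) * y (.inr (.inr (0, q))) := fun q =>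
    sub_eq_zero.1 (congrFun hx (.inr q))
  simp only [e1, block_value _ (-s) hs2]
  rw [mul_add, Finset.mul_sum, Finset.mul_sum]
  have hsin := abs_lt.1 (abs_sin_lt_one hα)
  have hneg : s * (2 * (Real.sin (a - α) + -s)) ≤ 0 := by
    rcases hs with rfl | rfl <;> linarith
  refine add_nonpos (Finset.sum_nonpos fun k _ => ?_) (Finset.sum_nonpos fun q _ => ?_)
  · by_cases hk : 0 < s * (θ k - α)
    · simp [eD k hk]
    · rw [← mul_assoc]
      exact mul_nonpos_of_nonpos_of_nonneg (mul_sin_nonpos hs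
        (abs_lt.2 ⟨by linarith [(h1 k).1], by linarith [(h1 k).2]⟩) hk) (Complex.normSq_nonneg _)
  · rw [← mul_assoc]
    exact mul_nonpos_of_nonpos_of_nonneg hneg (Complex.normSq_nonneg _)

theorem matForm_conjTranspose_mul_mul {n k : ℕ} (C : Matrix (Fin n) (Fin n) ℂ)
    (X : Matrix (Fin n) (Fin k) ℂ) (x : Fin k → ℂ) :
    matForm (Xᴴ * C * X) x x = matForm C (X *ᵥ x) (X *ᵥ x) := by
  rw [matForm_apply, matForm_apply, star_mulVec, ← dotProduct_mulVec, mulVec_mulVec,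
    mulVec_mulVec]

/-- Compression does not increase the number of phases on one side of an angle. -/
theorem card_phases_le {n k : ℕ} {C : Matrix (Fin n) (Fin n) ℂ} {B : Matrix (Fin k) (Fin k) ℂ}
    (hB : IsCompression B C) {a α s : ℝ} {J J' : Type} [Fintype J] [Fintype J'] {φ : J → ℝ}
    {ψ : J' → ℝ} (hφ : HasPhasesAt C a φ) (hψ : HasPhasesAt B a ψ) (hα : |α - a| < Real.pi / 2)
    (hs : s = 1 ∨ s = -1) :
    (Finset.univ.filter fun j => 0 < s * (ψ j - α)).card ≤
      (Finset.univ.filter fun j => 0 < s * (φ j - α)).card := by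
  obtain ⟨X, -, rfl⟩ := hB
  obtain ⟨K, _, L, hK, hL⟩ := hψ.exists_positive hα hs
  obtain ⟨K', _, G, hK', hG⟩ := hφ.exists_nonpositive hα hs
  rw [← hK, ← hK']
  -- A nonzero vector in the kernel would have a value both positive and nonpositive.
  have hinj : Function.Injective (G ∘ₗ Matrix.toLin' X ∘ₗ L) := by
    rw [← LinearMap.ker_eq_bot, Submodule.eq_bot_iff]
    intro c hc
    by_contra hne
    have h1 := hL c hne
    rw [matForm_conjTranspose_mul_mul] at h1
    exact absurd (hG (X *ᵥ L c) (by simpa using hc)) (not_le.2 h1)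
  simpa using LinearMap.finrank_le_finrank_of_injective hinj

theorem HasPhasesAt.bounds {n : ℕ} {C : Matrix (Fin n) (Fin n) ℂ} {a : ℝ} {J : Type}
    {φ : J → ℝ} (h : HasPhasesAt C a φ) (j : J) :
    a - Real.pi / 2 ≤ φ j ∧ φ j ≤ a + Real.pi / 2 := by
  obtain ⟨z, m, p, e, θ, T, σ, h1, h2, h3, h4⟩ := h
  have := Real.pi_pos
  rw [h4]
  rcases σ j with k | q | q
  · exact h1 k
  · simp only [Sum.elim_inl, Sum.elim_inr]; constructor <;> linarith
  · simp only [Sum.elim_inr]; constructor <;> linarith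

theorem HasPhasesAt.halfplane {n : ℕ} {C : Matrix (Fin n) (Fin n) ℂ} {a : ℝ} {J : Type}
    {φ : J → ℝ} (h : HasPhasesAt C a φ) (x : Fin n → ℂ) :
    0 ≤ (Complex.exp (-(a * Complex.I)) * matForm C x x).re := by
  obtain ⟨z, m, p, θ, Y, σ, h1, h2, h3⟩ := h.exists_coords
  -- The real part is the imaginary part for `α = a - π/2`; there all sines are nonnegative and a
  -- block becomes `|u + v|²`.
  have key : (Complex.exp (-(a * Complex.I)) * matForm C x x).re =
      (Complex.exp (-((a - Real.pi / 2 : ℝ) * Complex.I)) * matForm C x x).im := by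
    have : Complex.exp (-((a - Real.pi / 2 : ℝ) * Complex.I))
        = Complex.I * Complex.exp (-(a * Complex.I)) := by
      have h4 : -((a - Real.pi / 2 : ℝ) * Complex.I)
          = Real.pi / 2 * Complex.I + -(a * Complex.I) := by push_cast; ring
      rw [h4, Complex.exp_add, Complex.exp_pi_div_two_mul_I]
    rw [this, mul_assoc, Complex.I_mul_im]
  rw [key, h2, im_rotate_stdQuad]
  refine add_nonneg (Finset.sum_nonneg fun k _ => ?_) (Finset.sum_nonneg fun q _ => ?_)
  · have := h1 k
    exact mul_nonneg (Real.sin_nonneg_of_nonneg_of_le_pi (by linarith) (by linarith))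
      (Complex.normSq_nonneg _)
  · rw [show a - (a - Real.pi / 2) = Real.pi / 2 by ring, Real.sin_pi_div_two, one_mul]
    push_cast
    rw [Complex.exp_pi_div_two_mul_I, Complex.I_mul_im]
    generalize Y x (.inr (.inr (0, q))) = u
    generalize Y x (.inr (.inr (1, q))) = v
    have : Complex.normSq u + Complex.normSq v + 2 * (conj u * v).re = Complex.normSq (u + v) := by
      simp only [Complex.normSq_apply, Complex.mul_re, Complex.conj_re, Complex.conj_im,
        Complex.add_re, Complex.add_im]
      ring
    rw [this]
    exact Complex.normSq_nonneg _

/-! ### Changing the centre of a decomposition. -/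

theorem exists_int_shift {t : ℝ} (ht : 0 ≤ Real.cos t) :
    ∃ κ : ℤ, |t - 2 * Real.pi * κ| ≤ Real.pi / 2 := by
  have hpi := Real.pi_pos
  refine ⟨round (t / (2 * Real.pi)), ?_⟩
  set κ := round (t / (2 * Real.pi))
  have h1 : |t - 2 * Real.pi * κ| ≤ Real.pi := by
    have := abs_sub_round (t / (2 * Real.pi))
    have e : t - 2 * Real.pi * κ = 2 * Real.pi * (t / (2 * Real.pi) - κ) := by field_simp
    rw [e, abs_mul, abs_of_pos (by positivity : 0 < 2 * Real.pi)]
    nlinarith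
  by_contra! hcon
  have h2 := Real.cos_neg_of_pi_div_two_lt_of_lt hcon (by linarith)
  rw [Real.cos_abs, show t - 2 * Real.pi * κ = t - κ * (2 * Real.pi) by ring,
    Real.cos_sub_int_mul_two_pi] at h2
  linarith

theorem exp_shift (t : ℝ) (κ : ℤ) :
    Complex.exp ((t - 2 * Real.pi * κ : ℝ) * Complex.I) = Complex.exp (t * Complex.I) := by
  have : ((t - 2 * Real.pi * κ : ℝ) : ℂ) * Complex.I
      = t * Complex.I - κ * (2 * Real.pi * Complex.I) := by push_cast; ring
  rw [this, Complex.exp_periodic.sub_int_mul_eq]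

theorem exp_neg_mul_exp (a b : ℝ) :
    (Complex.exp (-(a * Complex.I)) * Complex.exp (b * Complex.I)) =
      Real.cos (b - a) + Real.sin (b - a) * Complex.I := by
  rw [← Complex.exp_add, show -(a * Complex.I) + b * Complex.I = ((b - a : ℝ) : ℂ) * Complex.I by
    push_cast; ring, Complex.exp_mul_I]
  simp

/-- Recentring: if the half-plane around `a` contains the numerical range, then phases with
respect to any centre become phases with respect to `a` after shifts by multiples of `2π`. -/
theorem HasPhasesAt.recenter {n : ℕ} {B : Matrix (Fin n) (Fin n) ℂ} {a b : ℝ} {J : Type}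
    {ψ : J → ℝ} (h : HasPhasesAt B b ψ)
    (ha : ∀ x, 0 ≤ (Complex.exp (-(a * Complex.I)) * matForm B x x).re) :
    ∃ κ : J → ℤ, HasPhasesAt B a (fun j => ψ j - 2 * Real.pi * κ j) := by
  obtain ⟨z, m, p, e, θ, T, σ, h1, h2, h3, h4⟩ := h
  have hq : ∀ y : Fin z ⊕ (Fin m ⊕ (Fin 2 × Fin p)) → ℂ,
      0 ≤ (Complex.exp (-(a * Complex.I)) * stdQuad b θ y).re := by
    intro y
    have := ha (T⁻¹ *ᵥ (y ∘ e.symm))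
    rw [matForm_eq_stdQuad h3, mulVec_mulVec, Matrix.mul_nonsing_inv _ h2, one_mulVec,
      Function.comp_assoc, Equiv.symm_comp_self, Function.comp_id] at this
    exact this
  -- Without blocks, each phase is tested on its own coordinate vector and shifted separately. With
  -- a block the half-plane is unique, so `a` and `b` agree modulo `2π` and one shift serves all
  -- phases.
  rcases Nat.eq_zero_or_pos p with rfl | hp
  · have hcos : ∀ k, 0 ≤ Real.cos (θ k - a) := by
      intro k
      have h5 := hq (Pi.single (.inr (.inl k)) 1)
      have h6 : stdQuad b θ (Pi.single (.inr (.inl k)) 1 : Fin z ⊕ (Fin m ⊕ (Fin 2 × Fin 0)) → ℂ)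
          = Complex.exp (θ k * Complex.I) := by
        rw [stdQuad, Finset.univ_eq_empty (α := Fin 0), Finset.sum_empty, add_zero,
          Finset.sum_eq_single k]
        · simp
        · intro k' _ hk'
          simp [hk']
        · simp
      rw [h6, exp_neg_mul_exp] at h5
      generalize Real.sin (θ k - a) = t at h5
      generalize Real.cos (θ k - a) = c at h5 ⊢
      simpa using h5
    choose κ hκ using fun k => exists_int_shift (hcos k)
    refine ⟨fun j => Sum.elim κ (fun _ => 0) (σ j), z, m, 0, e,
      fun k => θ k - 2 * Real.pi * κ k, T, σ, fun k => ?_, h2, ?_, fun j => ?_⟩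
    · have := abs_le.1 (hκ k)
      constructor <;> linarith
    · rw [h3]
      congr 3
      simp only [gsdMiddle, exp_shift]
      congr 2
      ext ⟨_, i⟩
      exact i.elim0
    · simp only [h4]
      rcases σ j with k | q | q
      · simp
      · exact q.elim0
      · exact q.elim0
  -- At `(1, -1 + iτ)` a block takes the value `e^{ib}(τ² + 2iτ)`, which for small `τ` leaves `0`
  -- along both directions of the boundary line.
  · have hτ : ∀ τ : ℝ, 0 ≤ τ ^ 2 * Real.cos (b - a) - 2 * τ * Real.sin (b - a) := by
      intro τ
      let q0 : Fin p := ⟨0, hp⟩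
      have h5 := hq (Sum.elim 0 (Sum.elim 0 fun i => if i.2 = q0 then ![1, -1 + τ * Complex.I] i.1
        else 0))
      have h6 : stdQuad b θ (Sum.elim 0 (Sum.elim 0 fun i => if i.2 = q0 then
          ![1, -1 + τ * Complex.I] i.1 else 0) : Fin z ⊕ (Fin m ⊕ (Fin 2 × Fin p)) → ℂ)
          = Complex.exp (b * Complex.I) * (τ ^ 2 + 2 * τ * Complex.I) := by
        rw [stdQuad, Finset.sum_eq_single q0]
        · simp [Complex.normSq_apply]
          ring
        · intro q _ hq
          simp [hq]
        · simp
      rw [h6, ← mul_assoc, exp_neg_mul_exp] at h5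
      generalize Real.sin (b - a) = t at h5 ⊢
      generalize Real.cos (b - a) = c at h5 ⊢
      simp [← Complex.ofReal_pow] at h5
      linarith
    have hs : Real.sin (b - a) = 0 := by
      by_contra hne
      -- This `τ` turns the inequality into `0 ≤ sin² (cos - 2)`, impossible unless the sine
      -- vanishes.
      have := hτ (Real.sin (b - a))
      have h7 := Real.cos_le_one (b - a)
      have h8 : 0 < Real.sin (b - a) ^ 2 := by positivity
      nlinarith
    have hc : Real.cos (b - a) = 1 := by
      have h7 := hτ 1
      have h8 := Real.sin_sq_add_cos_sq (b - a)
      rw [hs] at h7 h8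
      nlinarith
    obtain ⟨κ, hκ⟩ := (Real.cos_eq_one_iff _).1 hc
    refine ⟨fun _ => κ, z, m, p, e, fun k => θ k - 2 * Real.pi * κ, T, σ, fun k => ?_, h2, ?_,
      fun j => ?_⟩
    · have := h1 k
      constructor <;> linarith
    · rw [h3]
      have : a = b - 2 * Real.pi * κ := by linarith
      congr 3
      simp only [gsdMiddle, this, exp_shift]
    · simp only [h4]
      rcases σ j with k | q | q <;> simp <;> linarith

/-! ### Interlacing for a common centre. -/

theorem interlace {n k : ℕ} {C : Matrix (Fin n) (Fin n) ℂ} {B : Matrix (Fin k) (Fin k) ℂ}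
    (hB : IsCompression B C) {a : ℝ} {φ : Fin C.rank → ℝ} {ψ : Fin B.rank → ℝ}
    (hφa : Antitone φ) (hψa : Antitone ψ) (hφ : HasPhasesAt C a φ) (hψ : HasPhasesAt B a ψ)
    (j : Fin B.rank) :
    ψ j ≤ φ (Fin.castLE hB.rank_le j) ∧ φ ⟨C.rank - B.rank + (j : ℕ), hB.index_lt j⟩ ≤ ψ j := by
  -- The midpoint of two distinct points of the closed interval is interior, as `card_phases_le`
  -- requires.
  have hmid : ∀ u v : ℝ, a - Real.pi / 2 ≤ u → u < v → v ≤ a + Real.pi / 2 →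
      |(u + v) / 2 - a| < Real.pi / 2 := fun u v h1 h2 h3 =>
    abs_lt.2 ⟨by linarith, by linarith⟩
  constructor
  -- With `α` the midpoint, at least `j + 1` entries of `ψ` but at most `j` of `φ` exceed it.
  · by_contra! hlt
    set i := Fin.castLE hB.rank_le j
    have hc := card_phases_le hB hφ hψ (hmid _ _ (hφ.bounds i).1 hlt (hψ.bounds j).2) (.inl rfl)
    have h1 : (Finset.Iic j).card ≤
        (Finset.univ.filter fun l => 0 < 1 * (ψ l - (φ i + ψ j) / 2)).card := by
      refine Finset.card_le_card fun l hl => ?_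
      have := hψa (Finset.mem_Iic.1 hl)
      simp only [Finset.mem_filter, Finset.mem_univ, true_and]; linarith
    have h2 : (Finset.univ.filter fun l => 0 < 1 * (φ l - (φ i + ψ j) / 2)).card ≤
        (Finset.Iio i).card := by
      refine Finset.card_le_card fun l hl => ?_
      simp only [Finset.mem_filter, Finset.mem_univ, true_and] at hl
      rw [Finset.mem_Iio]
      by_contra! hle
      have := hφa hle
      linarith
    rw [Fin.card_Iic] at h1
    rw [Fin.card_Iio] at h2
    have : (i : ℕ) = j := rfl
    omega
  -- From below: at least `B.rank - j` entries of `ψ` but at most `B.rank - j - 1` of `φ` are less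
  -- than the midpoint.
  · by_contra! hlt
    set i : Fin C.rank := ⟨C.rank - B.rank + (j : ℕ), hB.index_lt j⟩
    have hc := card_phases_le hB hφ hψ (hmid _ _ (hψ.bounds j).1 hlt (hφ.bounds i).2) (.inr rfl)
    have h1 : (Finset.Ici j).card ≤
        (Finset.univ.filter fun l => 0 < -1 * (ψ l - (ψ j + φ i) / 2)).card := by
      refine Finset.card_le_card fun l hl => ?_
      have := hψa (Finset.mem_Ici.1 hl)
      simp only [Finset.mem_filter, Finset.mem_univ, true_and]; linarith
    have h2 : (Finset.univ.filter fun l => 0 < -1 * (φ l - (ψ j + φ i) / 2)).card ≤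
        (Finset.Ioi i).card := by
      refine Finset.card_le_card fun l hl => ?_
      simp only [Finset.mem_filter, Finset.mem_univ, true_and] at hl
      rw [Finset.mem_Ioi]
      by_contra! hle
      have := hφa hle
      linarith
    rw [Fin.card_Ici] at h1
    rw [Fin.card_Ioi] at h2
    have : (i : ℕ) = C.rank - B.rank + j := rfl
    have := hB.rank_le
    have := j.isLt
    omega

/-- Every phase of a compression lies between two phases of the matrix, for a common centre. -/
theorem exists_phases_between {n k : ℕ} {C : Matrix (Fin n) (Fin n) ℂ}
    {B : Matrix (Fin k) (Fin k) ℂ} (hB : IsCompression B C) {a : ℝ} {φ : Fin C.rank → ℝ}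
    {ψ : Fin B.rank → ℝ} (hφa : Antitone φ) (hφ : HasPhasesAt C a φ) (hψ : HasPhasesAt B a ψ)
    (j : Fin B.rank) : (∃ i, ψ j ≤ φ i) ∧ ∃ i, φ i ≤ ψ j := by
  set τ := Tuple.sort (fun j => - ψ j)
  have hτ : Antitone (ψ ∘ τ) := fun i j hij => by
    simpa using Tuple.monotone_sort (fun j => - ψ j) hij
  have := interlace hB hφa hτ hφ (hψ.comp_equiv τ) (τ.symm j)
  simp only [Function.comp_apply, Equiv.apply_symm_apply] at this
  exact ⟨⟨_, this.1⟩, _, this.2⟩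

/-! ### Phase centers and the choice of a common centre. -/

theorem phaseCenter_mem {r : ℕ} (hr : 0 < r) {φ : Fin r → ℝ} {l u : ℝ}
    (h : ∀ j, l ≤ φ j ∧ φ j ≤ u) : l ≤ phaseCenter φ ∧ phaseCenter φ ≤ u := by
  have : Nonempty (Fin r) := ⟨⟨0, hr⟩⟩
  have h1 : ⨆ i, φ i ≤ u := ciSup_le fun j => (h j).2
  have h2 : l ≤ ⨅ i, φ i := le_ciInf fun j => (h j).1
  have h3 : ⨅ i, φ i ≤ ⨆ i, φ i :=
    ciInf_le_ciSup (Finite.bddBelow_range φ) (Finite.bddAbove_range φ)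
  rw [phaseCenter]
  constructor <;> linarith

theorem phaseCenter_eq {r : ℕ} {φ : Fin r → ℝ} {l u : ℝ}
    (h : ∀ j, l ≤ φ j ∧ φ j ≤ u) (hl : ∃ j, φ j ≤ l) (hu : ∃ j, u ≤ φ j) :
    phaseCenter φ = (u + l) / 2 := by
  obtain ⟨i, hi⟩ := hl
  obtain ⟨j, hj⟩ := hu
  have : Nonempty (Fin r) := ⟨i⟩
  have h1 : ⨆ i, φ i = u := le_antisymm (ciSup_le fun j => (h j).2)
    (hj.trans (le_ciSup (Finite.bddAbove_range φ) j))
  have h2 : ⨅ i, φ i = l := le_antisymm ((ciInf_le (Finite.bddBelow_range φ) i).trans hi)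
    (le_ciInf fun j => (h j).1)
  rw [phaseCenter, h1, h2]

theorem rank_pos_of_ne_zero {n : ℕ} {C : Matrix (Fin n) (Fin n) ℂ} (hC : C ≠ 0) : 0 < C.rank := by
  rw [Nat.pos_iff_ne_zero]
  intro h
  have h1 := Submodule.finrank_eq_zero.1 h
  rw [LinearMap.range_eq_bot] at h1
  exact hC (Matrix.mulVec_injective (funext fun v => by simpa using congrArg (fun f => f v) h1))

/-- The phases of `B` lie between the extreme phases of `C`, which are at most `π` apart, so the
centers in fact differ by at most `π/2`. -/
theorem abs_phaseCenter_sub_lt {n k : ℕ} {C : Matrix (Fin n) (Fin n) ℂ}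
    {B : Matrix (Fin k) (Fin k) ℂ} (hB : IsCompression B C) (hB0 : B ≠ 0) {a : ℝ}
    {φ : Fin C.rank → ℝ} {ψ : Fin B.rank → ℝ} (hφa : Antitone φ) (hφ : HasPhasesAt C a φ)
    (hψ : HasPhasesAt B a ψ) : |phaseCenter ψ - phaseCenter φ| < Real.pi := by
  have hpi := Real.pi_pos
  have j0 : Fin B.rank := ⟨0, rank_pos_of_ne_zero hB0⟩
  have : Nonempty (Fin B.rank) := ⟨j0⟩
  have : Nonempty (Fin C.rank) := ⟨Fin.castLE hB.rank_le j0⟩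
  have h1 : ⨆ i, ψ i ≤ ⨆ i, φ i := ciSup_le fun j => by
    obtain ⟨i, hi⟩ := (exists_phases_between hB hφa hφ hψ j).1
    exact hi.trans (le_ciSup (Finite.bddAbove_range φ) i)
  have h2 : ⨅ i, φ i ≤ ⨅ i, ψ i := le_ciInf fun j => by
    obtain ⟨i, hi⟩ := (exists_phases_between hB hφa hφ hψ j).2
    exact (ciInf_le (Finite.bddBelow_range φ) i).trans hi
  have h3 : ⨆ i, φ i ≤ a + Real.pi / 2 := ciSup_le fun j => (hφ.bounds j).2
  have h4 : a - Real.pi / 2 ≤ ⨅ i, φ i := le_ciInf fun j => (hφ.bounds j).1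
  have h5 : ⨅ i, ψ i ≤ ⨆ i, ψ i :=
    ciInf_le_ciSup (Finite.bddBelow_range ψ) (Finite.bddAbove_range ψ)
  rw [phaseCenter, phaseCenter, abs_lt]
  constructor <;> linarith

/-- Selections of phases of `C` and of a compression with phase centres less than `π` apart can be
taken with respect to the same central direction. -/
theorem HasPhasesAt.of_abs_phaseCenter_sub_lt {n k : ℕ} {C : Matrix (Fin n) (Fin n) ℂ}
    {B : Matrix (Fin k) (Fin k) ℂ} (hB : IsCompression B C) (hB0 : B ≠ 0) {a b : ℝ}
    {φ : Fin C.rank → ℝ} {ψ : Fin B.rank → ℝ} (hφa : Antitone φ) (hφ : HasPhasesAt C a φ)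
    (hψ : HasPhasesAt B b ψ) (hlt : |phaseCenter ψ - phaseCenter φ| < Real.pi) :
    HasPhasesAt B a ψ := by
  have hpi := Real.pi_pos
  have hBr := rank_pos_of_ne_zero hB0
  have hCr := hBr.trans_le hB.rank_le
  have hlt' := abs_lt.1 hlt
  obtain ⟨κ, hκ⟩ := hψ.recenter (a := a) (by
    obtain ⟨X, -, rfl⟩ := hB
    intro x
    rw [matForm_conjTranspose_mul_mul]
    exact hφ.halfplane _)
  have hb1 := hψ.bounds
  have hb2 := hκ.bounds
  -- Unequal shifts are possible only if `ψ` attains both `b ± π/2` and its shift attains both `a ±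
  -- π/2`. By interlacing `φ` attains `a ± π/2` too, so the phase centers are `b` and `a`, which
  -- differ by an odd multiple of `π`; the strict bound excludes this.
  have hconst : ∀ i j, κ i ≤ κ j := by
    intro j i
    by_contra! hij
    have hij' : (κ i : ℝ) + 1 ≤ κ j := by exact_mod_cast hij
    have e1 : 2 * Real.pi ≤ 2 * Real.pi * (κ j - κ i) := by nlinarith
    have e2 := hb1 i
    have e3 := hb1 j
    have e4 := hb2 i
    have e5 := hb2 j
    have hψc : phaseCenter ψ = b := by
      rw [phaseCenter_eq hb1 ⟨i, by linarith⟩ ⟨j, by linarith⟩]; ring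
    have hφc : phaseCenter φ = a := by
      obtain ⟨i', hi'⟩ := (exists_phases_between hB hφa hφ hκ i).1
      obtain ⟨j', hj'⟩ := (exists_phases_between hB hφa hφ hκ j).2
      rw [phaseCenter_eq hφ.bounds ⟨j', by linarith⟩ ⟨i', by linarith⟩]; ring
    rw [hψc, hφc] at hlt'
    have e6 : b - a = Real.pi * (2 * κ j - 1) := by linarith
    rcases le_or_gt 1 (κ j) with h | h
    · have : (1 : ℝ) ≤ κ j := by exact_mod_cast h
      nlinarith
    · have : (κ j : ℝ) ≤ 0 := by exact_mod_cast Int.lt_add_one_iff.1 h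
      nlinarith
  set κ₀ := κ ⟨0, hBr⟩
  have hκ₀ : ∀ j, κ j = κ₀ := fun j => le_antisymm (hconst _ _) (hconst _ _)
  have h1 := phaseCenter_mem hCr hφ.bounds
  have h2 := phaseCenter_mem hBr (φ := ψ) (l := a - Real.pi / 2 + 2 * Real.pi * κ₀)
    (u := a + Real.pi / 2 + 2 * Real.pi * κ₀) fun j => by
      have := hb2 j
      rw [hκ₀ j] at this
      constructor <;> linarith
  -- The phase centers lie in intervals of length `π` centred at `a + 2πκ₀` and `a`, so a nonzero
  -- shift would put them at least `π` apart.
  have hzero : κ₀ = 0 := by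
    apply le_antisymm
    · by_contra! h
      have : (1 : ℝ) ≤ κ₀ := by exact_mod_cast h
      nlinarith
    · by_contra! h
      have : (κ₀ : ℝ) ≤ -1 := by exact_mod_cast Int.le_sub_one_of_lt h
      nlinarith
  simpa [hκ₀, hzero] using hκ

theorem IsCompression.isSemiSectorial {n k : ℕ} {C : Matrix (Fin n) (Fin n) ℂ}
    {B : Matrix (Fin k) (Fin k) ℂ} (hB : IsCompression B C) {a : ℝ}
    (ha : ∀ x, 0 ≤ (Complex.exp (-(a * Complex.I)) * matForm C x x).re) : IsSemiSectorial B := by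
  obtain ⟨X, -, rfl⟩ := hB
  have hB : ∀ x, 0 ≤ (Complex.exp (-(a * Complex.I)) * matForm (Xᴴ * C * X) x x).re := fun x => by
    rw [matForm_conjTranspose_mul_mul]
    exact ha _
  refine isSemiSectorial_of_halfplane (fun hu => ?_) a hB
  -- The direction opposite to `a` is outside the half-plane, so the range is not the whole plane.
  obtain ⟨x, -, hx⟩ : -Complex.exp (a * Complex.I) ∈ angularNumericalRange (Xᴴ * C * X) :=
    hu ▸ Set.mem_univ _
  have := hB x
  rw [matForm_apply, ← hx, mul_neg, ← Complex.exp_add] at this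
  norm_num at this

end MatrixPhase

theorem lemma4p3 {n k : ℕ} (C : Matrix (Fin n) (Fin n) ℂ) (B : Matrix (Fin k) (Fin k) ℂ)
    (hC0 : C ≠ 0) (hC : MatrixPhase.IsSemiSectorial C)
    (hB : MatrixPhase.IsCompression B C) (hB0 : B ≠ 0) :
    MatrixPhase.IsSemiSectorial B ∧
    (∃ φ : Fin C.rank → ℝ, MatrixPhase.IsPhases C φ) ∧
    ∀ φ : Fin C.rank → ℝ, MatrixPhase.IsPhases C φ →
      (∃ ψ : Fin B.rank → ℝ, MatrixPhase.IsPhases B ψ ∧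
        |MatrixPhase.phaseCenter ψ - MatrixPhase.phaseCenter φ| < Real.pi) ∧
      ∀ ψ : Fin B.rank → ℝ, MatrixPhase.IsPhases B ψ →
        |MatrixPhase.phaseCenter ψ - MatrixPhase.phaseCenter φ| < Real.pi →
        ∀ j : Fin B.rank,
          φ (Fin.castLE hB.rank_le j) ≥ ψ j ∧
          ψ j ≥ φ ⟨C.rank - B.rank + (j : ℕ), hB.index_lt j⟩ := by
  obtain ⟨a, ha⟩ := MatrixPhase.exists_halfplane_of_ne_univ hC.ne_univ
  refine ⟨hB.isSemiSectorial ha, ?_, fun φ hφ => ?_⟩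
  · obtain ⟨φ, h1, h2⟩ := MatrixPhase.exists_hasPhasesAt C a ha
    exact ⟨φ, MatrixPhase.isPhases_iff.2 ⟨h1, a, h2⟩⟩
  obtain ⟨hφa, c, hφc⟩ := MatrixPhase.isPhases_iff.1 hφ
  refine ⟨?_, fun ψ hψ hlt j => ?_⟩
  -- The witness is taken with the centre `c` of the given selection `φ`, whose half-plane also
  -- contains the values of `B`.
  · obtain ⟨ψ, h1, h2⟩ := MatrixPhase.exists_hasPhasesAt B c fun x => by
      obtain ⟨X, -, rfl⟩ := hB
      rw [← MatrixPhase.matForm_apply, MatrixPhase.matForm_conjTranspose_mul_mul]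
      exact hφc.halfplane _
    exact ⟨ψ, MatrixPhase.isPhases_iff.2 ⟨h1, c, h2⟩,
      MatrixPhase.abs_phaseCenter_sub_lt hB hB0 hφa hφc h2⟩
  · obtain ⟨hψa, b, hψb⟩ := MatrixPhase.isPhases_iff.1 hψ
    exact MatrixPhase.interlace hB hφa hψa hφc
      (MatrixPhase.HasPhasesAt.of_abs_phaseCenter_sub_lt hB hB0 hφa hφc hψb hlt) j
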